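/- Let $n\ge 1$ and $0\le k<n$ be integers and let $s\in[0,n]$ be real. For $x\in\mathbb{R}^n$ and $r>0$, the $k$-skeleton of the axes-parallel cube with centre $x$ and side length $2r$ is $$x+\bigcup_{I\subseteq\{1,\dots,n\},\,|I|=k}\ \prod_{i=1}^n A_{i,I},\qquad A_{i,I}=[-r,r]\text{ if } i\in I,\quad A_{i,I}=\{-r,r\}\text{ if } i\notin I.$$ Say that $B\subseteq\mathbb{R}^n$ contains the $k$-skeleton of a cube around every point of $S\subseteq\mathbb{R}^n$ if for every $x\in S$ there is $r>0$ such that $B$ contains the $k$-skeleton of the axes-parallel cube with centre $x$ and side length $2r$. Let $\dim_P$ denote packing dimension, and write $\dim_B(A)=d$ if the lower and the upper box counting dimension of $A$ are both equal to $d$. Then: 1. There are compact sets $S,B\subseteq\mathbb{R}^n$, with $S$ nonempty, such that $B$ contains the $k$-skeleton of a cube around every point of $S$, $$\dim_P(S)=s\quad\text{and}\quad \dim_P(B)=k+\frac{(n-k)(2n-1)}{2n^2}\,s.$$ 2. There are compact sets $S',B'\subseteq\mathbb{R}^n$, with $S'$ nonempty, such that $B'$ contains the $k$-skeleton of a cube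 around every point of $S'$, $$\dim_B(S')=s\quad\text{and}\quad \dim_B(B')=\max\left\{k,\left(1-\frac{n-k}{2n^2}\right)s\right\}.$$ -/

import Mathlib

open Set Filter Topology
open scoped NNReal ENNReal

noncomputable section

/-- The closed `k`-dimensional skeleton of the axes-parallel cube `∏ᵢ [cᵢ - r, cᵢ + r]` with
centre `c` and side length `2r`: the union over all `k`-element sets `I` of coordinates of the
products whose `i`-th factor is the whole interval for `i ∈ I` and its two endpoints for `i ∉ I`. -/
def cubeSkeleton {n : ℕ} (k : ℕ) (c : EuclideanSpace ℝ (Fin n)) (r : ℝ) :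
    Set (EuclideanSpace ℝ (Fin n)) :=
  {y | ∃ I : Finset (Fin n), I.card = k ∧
    ∀ i, (i ∈ I → y i ∈ Icc (c i - r) (c i + r)) ∧
      (i ∉ I → y i ∈ ({c i - r, c i + r} : Set ℝ))}

/-- `B` contains the `k`-skeleton of a (nondegenerate, axes-parallel) cube around every point
of `S`. -/
def ContainsSkeletonAroundEach {n : ℕ} (k : ℕ) (B S : Set (EuclideanSpace ℝ (Fin n))) : Prop :=
  ∀ x ∈ S, ∃ r : ℝ, 0 < r ∧ cubeSkeleton k x r ⊆ B

section Dimensions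

variable {X : Type*} [PseudoMetricSpace X]

/-- `log N_ε(A) / (-log ε)`, where `N_ε(A)` is the least number of closed balls of radius `ε`
that cover `A`. -/
def boxRatio (A : Set X) (ε : ℝ≥0) : EReal :=
  ENNReal.log (Metric.externalCoveringNumber ε A : ℝ≥0∞) / ((-Real.log (ε : ℝ) : ℝ) : EReal)

/-- The upper box counting dimension. -/
def upperBoxDim (A : Set X) : EReal :=
  limsup (boxRatio A) (𝓝[>] (0 : ℝ≥0))

/-- The lower box counting dimension. -/
def lowerBoxDim (A : Set X) : EReal :=
  liminf (boxRatio A) (𝓝[>] (0 : ℝ≥0))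

/-- The box counting dimension of `A` exists and equals `d`: the lower and the upper box counting
dimension are both equal to `d`. -/
def HasBoxDim (A : Set X) (d : ℝ) : Prop :=
  lowerBoxDim A = (d : EReal) ∧ upperBoxDim A = (d : EReal)

/-- A `δ`-packing of `F`: a collection of pairwise disjoint closed balls, given by their centres
and radii, with centres in `F` and radii in `(0, δ]`. -/
def IsPacking (δ : ℝ) (F : Set X) (P : Set (X × ℝ)) : Prop :=
  (∀ p ∈ P, p.1 ∈ F ∧ 0 < p.2 ∧ p.2 ≤ δ) ∧
    P.PairwiseDisjoint (fun p => Metric.closedBall p.1 p.2)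

/-- The supremum of `∑ (2 rᵢ) ^ s` over all `δ`-packings of `F` by balls of radii `rᵢ`. -/
def packingSup (s : ℝ≥0) (δ : ℝ) (F : Set X) : ℝ≥0∞ :=
  ⨆ (P : Set (X × ℝ)) (_ : IsPacking δ F P),
    ∑' p : P, ENNReal.ofReal (2 * p.1.2) ^ (s : ℝ)

/-- The `s`-dimensional packing premeasure: the limit (infimum) of `packingSup s δ F` as `δ`
decreases to `0`. -/
def packingPremeasure (s : ℝ≥0) (F : Set X) : ℝ≥0∞ :=
  ⨅ (δ : ℝ) (_ : 0 < δ), packingSup s δ F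

/-- The `s`-dimensional packing (outer) measure: the infimum of the sums of the premeasures over
all countable covers of `F`. -/
def packingMeasure (s : ℝ≥0) (F : Set X) : ℝ≥0∞ :=
  ⨅ (t : ℕ → Set X) (_ : F ⊆ ⋃ i, t i), ∑' i, packingPremeasure s (t i)

/-- The packing dimension: the infimum of the exponents `s ≥ 0` for which the `s`-dimensional
packing measure vanishes. -/
def packingDim (F : Set X) : ℝ≥0∞ :=
  ⨅ (s : ℝ≥0) (_ : packingMeasure s F = 0), (s : ℝ≥0∞)

end Dimensions

end

/-! Fix `b = 2 ^ (-1 / θ)` with `0 < θ ≤ 1` and expand numbers in blocks: the digit `e j` runs over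
`0, …, 2 ^ j - 1` and has weight `b ^ tri (j + 1)`. The first `M` digits take `2 ^ tri M` values and
determine the number up to `b ^ tri M = 2 ^ (-tri M / θ)`, so such numbers form a set of dimension
`θ`, and their `n`-fold product `stdProd` has dimension `n * θ`.

The gain comes from `exists_common_radius`. Given `x` in the product, let `ρ` copy the digits of `-x
i` at places congruent to `2 * i` modulo `2 * n`, and those of `x i` at places congruent to `2 * i +
1`. Then every `x i + ρ` and `x i - ρ` has vanishing digits along one of the `2 * n` residue
classes, so it lies in `gapSet`, whose covering exponent is `θ * (1 - 1 / (2 * n))`. With `r = 2 +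
ρ` the `k`-skeleton around `x` lies in `skelSet`: `k` coordinates are free in a bounded interval and
`n - k` lie in two translates of `gapSet`. This gives the exponent `k + (n - k) * θ * (1 - 1 / (2 *
n))`, and `θ = s / n` yields the packing statement.

For box dimension the cost of the `k` free directions is reduced by working at many scales. Put `τ =
s / n` and `b = 1 / 2`, keep only the first `J` digits, and scale the result by `pieceScale τ J`.
The `J`-th piece of centres is then a grid of mesh `δ = 2 ^ (-tri J / τ)` in a cube of side about `δ
^ (1 - τ)`. The union over `J` has box dimension `n * τ = s`. The matching skeleton pieces look
`u`-dimensional above their mesh and `k`-dimensional below it, where `u = k + (n - k) * (1 - 1 / (2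
* n))`; `coverBound_insert_iUnion_smul` turns this into `max k (u * τ)`. The end cases `s = 0` and
`s = n` are served by the first construction, where the two formulas agree.

The skeleton sets need only upper bounds: a compact set `D` of exactly the desired dimension
(`exists_isCompact_dim_eq`) is adjoined to each. All upper bounds are covering estimates
(`CoverBound`). Lower bounds come from Hausdorff dimension, which is at most both the packing and
the lower box dimension, and is computed for `stdProd` by a Hölder map onto a cube. The exception is
the multiscale set of centres: it is countable, so its grid points are counted directly. -/

noncomputable section

/-! ### Covering numbers and box dimension -/

section CoveringBounds

variable {X : Type*} [PseudoMetricSpace X]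

/-- `A` is covered by at most `N` closed balls of radius `ε`. -/
def Covers (A : Set X) (ε N : ℝ) : Prop :=
  ∃ F : Finset X, (F.card : ℝ) ≤ N ∧ A ⊆ ⋃ x ∈ F, Metric.closedBall x ε

lemma Covers.mono {A A' : Set X} {ε ε' N N' : ℝ} (h : Covers A ε N) (hA : A' ⊆ A)
    (hε : ε ≤ ε') (hN : N ≤ N') : Covers A' ε' N' := by
  obtain ⟨F, hF, hc⟩ := h
  exact ⟨F, hF.trans hN, hA.trans (hc.trans
    (iUnion₂_mono fun x _ => Metric.closedBall_subset_closedBall hε))⟩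

lemma Covers.nonneg {A : Set X} {ε N : ℝ} (h : Covers A ε N) : 0 ≤ N := by
  obtain ⟨F, hF, -⟩ := h
  exact (Nat.cast_nonneg _).trans hF

lemma Covers.union {A B : Set X} {ε M N : ℝ} (hA : Covers A ε M) (hB : Covers B ε N) :
    Covers (A ∪ B) ε (M + N) := by
  classical
  obtain ⟨F, hF, hcF⟩ := hA
  obtain ⟨G, hG, hcG⟩ := hB
  refine ⟨F ∪ G, ?_, ?_⟩
  · have : ((F ∪ G).card : ℝ) ≤ F.card + G.card := by exact_mod_cast Finset.card_union_le F G
    linarith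
  · rintro x (hx | hx)
    · obtain ⟨y, hy, hxy⟩ := mem_iUnion₂.1 (hcF hx)
      exact mem_iUnion₂.2 ⟨y, Finset.mem_union_left _ hy, hxy⟩
    · obtain ⟨y, hy, hxy⟩ := mem_iUnion₂.1 (hcG hx)
      exact mem_iUnion₂.2 ⟨y, Finset.mem_union_right _ hy, hxy⟩

lemma Covers.empty (ε : ℝ) : Covers (∅ : Set X) ε 0 := ⟨∅, by simp, by simp⟩

lemma Covers.biUnion {ι : Type*} (s : Finset ι) {A : ι → Set X} {ε : ℝ} {N : ι → ℝ}
    (h : ∀ i ∈ s, Covers (A i) ε (N i)) : Covers (⋃ i ∈ s, A i) ε (∑ i ∈ s, N i) := by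
  classical
  induction s using Finset.induction_on with
  | empty => simpa using Covers.empty ε
  | insert a s ha ih =>
    rw [Finset.set_biUnion_insert, Finset.sum_insert ha]
    exact (h a (by simp)).union (ih fun i hi => h i (by simp [hi]))

lemma Covers.singleton (x : X) {ε : ℝ} (hε : 0 ≤ ε) : Covers {x} ε 1 :=
  ⟨{x}, by simp, by simp [hε]⟩

lemma externalCoveringNumber_le_of_covers {A : Set X} {ε : ℝ≥0} {N : ℝ} (h : Covers A ε N) :
    (Metric.externalCoveringNumber ε A : ℝ≥0∞) ≤ ENNReal.ofReal N := by
  obtain ⟨F, hF, hc⟩ := h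
  have h1 : Metric.externalCoveringNumber ε A ≤ (F : Set X).encard :=
    (Metric.isCover_iff_subset_iUnion_closedBall.2
      (by simpa using hc)).externalCoveringNumber_le_encard
  rw [Set.encard_coe_eq_coe_finsetCard] at h1
  calc (Metric.externalCoveringNumber ε A : ℝ≥0∞) ≤ ((F.card : ℕ∞) : ℝ≥0∞) := by
        exact_mod_cast h1
    _ = ENNReal.ofReal (F.card : ℝ) := by simp
    _ ≤ _ := ENNReal.ofReal_le_ofReal hF

lemma le_externalCoveringNumber_of_covers {A : Set X} {ε : ℝ≥0} {a : ℝ}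
    (h : ∀ N, Covers A ε N → a ≤ N) :
    ENNReal.ofReal a ≤ (Metric.externalCoveringNumber ε A : ℝ≥0∞) := by
  by_contra! hlt
  have hne : Metric.externalCoveringNumber ε A ≠ ⊤ := by
    intro h'; rw [h'] at hlt; simp at hlt
  obtain ⟨m, hm⟩ := ENat.ne_top_iff_exists.1 hne
  rw [← hm] at hlt
  have hlt2 : Metric.externalCoveringNumber ε A < ((m + 1 : ℕ) : ℕ∞) := by
    rw [← hm]; exact_mod_cast Nat.lt_succ_self m
  simp only [Metric.externalCoveringNumber, iInf_lt_iff] at hlt2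
  obtain ⟨C, hC, hCm⟩ := hlt2
  have hfin : C.Finite := Set.finite_of_encard_le_coe hCm.le
  have hcard : (hfin.toFinset.card : ℝ) ≤ m := by
    rw [hfin.encard_eq_coe_toFinset_card] at hCm
    have : hfin.toFinset.card < m + 1 := by exact_mod_cast hCm
    exact_mod_cast Nat.lt_succ_iff.1 this
  have := h m ⟨hfin.toFinset, hcard, by
    simpa using Metric.isCover_iff_subset_iUnion_closedBall.1 hC⟩
  have h2 : ENNReal.ofReal a ≤ ENNReal.ofReal m := ENNReal.ofReal_le_ofReal this
  simp at h2
  exact absurd hlt (not_lt.2 (by simpa using h2))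

/-- The covering numbers of `A` grow at most like `ε ^ (-t')` for every `t' > t`. -/
def CoverBound (A : Set X) (t : ℝ) : Prop :=
  ∀ t' > t, ∃ C : ℝ, ∀ ε : ℝ, 0 < ε → ε ≤ 1 → Covers A ε (C * ε ^ (-t'))

/-- The covering numbers of `A` grow at least like `ε ^ (-t')` for every `t' < t`. -/
def CoverLowerBound (A : Set X) (t : ℝ) : Prop :=
  ∀ t' < t, ∃ c > 0, ∃ ε₀ > 0, ∀ ε : ℝ, 0 < ε → ε < ε₀ → ∀ N, Covers A ε N → c * ε ^ (-t') ≤ N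

lemma CoverBound.mono {A A' : Set X} {t t' : ℝ} (h : CoverBound A t) (hA : A' ⊆ A)
    (ht : t ≤ t') : CoverBound A' t' := fun u hu => by
  obtain ⟨C, hC⟩ := h u (ht.trans_lt hu)
  exact ⟨C, fun ε h0 h1 => (hC ε h0 h1).mono hA le_rfl le_rfl⟩

lemma CoverBound.union {A B : Set X} {t : ℝ} (hA : CoverBound A t) (hB : CoverBound B t) :
    CoverBound (A ∪ B) t := fun u hu => by
  obtain ⟨C, hC⟩ := hA u hu
  obtain ⟨D, hD⟩ := hB u hu
  exact ⟨C + D, fun ε h0 h1 => by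
    rw [add_mul]; exact (hC ε h0 h1).union (hD ε h0 h1)⟩

lemma CoverLowerBound.mono {A A' : Set X} {t : ℝ} (h : CoverLowerBound A t) (hA : A ⊆ A') :
    CoverLowerBound A' t := fun u hu => by
  obtain ⟨c, hc, ε₀, h0, H⟩ := h u hu
  exact ⟨c, hc, ε₀, h0, fun ε h1 h2 N hN => H ε h1 h2 N (hN.mono hA le_rfl le_rfl)⟩

lemma tendsto_neg_log_nhdsGT_zero :
    Tendsto (fun ε : ℝ≥0 => -Real.log (ε : ℝ)) (𝓝[>] 0) atTop := by
  have h : Tendsto (fun ε : ℝ≥0 => (ε : ℝ)) (𝓝[>] 0) (𝓝[>] 0) := by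
    refine tendsto_nhdsWithin_iff.2 ⟨?_, ?_⟩
    · exact (NNReal.continuous_coe.tendsto' 0 0 rfl).mono_left nhdsWithin_le_nhds
    · filter_upwards [self_mem_nhdsWithin] with ε hε
      exact NNReal.coe_pos.2 hε
  exact tendsto_neg_atBot_atTop.comp (Real.tendsto_log_nhdsGT_zero.comp h)

lemma upperBoxDim_le_of_coverBound {A : Set X} {t : ℝ} (h : CoverBound A t) :
    upperBoxDim A ≤ (t : EReal) := by
  refine EReal.le_of_forall_lt_iff_le.1 fun z hz => ?_
  have hz' : t < z := by exact_mod_cast hz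
  obtain ⟨u, hu1, hu2⟩ := exists_between hz'
  obtain ⟨C, hC⟩ := h u hu1
  refine limsup_le_of_le (by isBoundedDefault) ?_
  have hlog := tendsto_neg_log_nhdsGT_zero.eventually_ge_atTop
    (max 1 (Real.log (max C 1) / (z - u)))
  filter_upwards [hlog, self_mem_nhdsWithin] with ε hε hpos
  have hpos : (0 : ℝ) < ε := NNReal.coe_pos.2 hpos
  have h1 : 1 ≤ -Real.log ε := (le_max_left _ _).trans hε
  have h2 : Real.log (max C 1) ≤ -Real.log ε * (z - u) :=
    (div_le_iff₀ (by linarith)).1 ((le_max_right _ _).trans hε)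
  have hε1 : (ε : ℝ) ≤ 1 := by
    by_contra! hgt
    have := Real.log_pos hgt
    linarith
  have hpow : 0 < (ε : ℝ) ^ (-u) := Real.rpow_pos_of_pos hpos _
  have hcov := (hC ε hpos hε1).mono subset_rfl le_rfl
    (mul_le_mul_of_nonneg_right (le_max_left C 1) hpow.le)
  have hCpos : 0 < max C 1 * (ε : ℝ) ^ (-u) := by positivity
  have h3 : ENNReal.log (Metric.externalCoveringNumber ε A : ℝ≥0∞) ≤
      ((z * -Real.log ε : ℝ) : EReal) := by
    refine (ENNReal.log_monotone (externalCoveringNumber_le_of_covers hcov)).trans ?_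
    rw [ENNReal.log_ofReal_of_pos hCpos, Real.log_mul (by positivity) hpow.ne',
      Real.log_rpow hpos]
    exact_mod_cast (by linarith)
  unfold boxRatio
  rw [EReal.div_le_iff_le_mul (by exact_mod_cast (by linarith)) (EReal.coe_ne_top _)]
  rw [mul_comm]
  exact_mod_cast h3

lemma le_lowerBoxDim_of_coverLowerBound {A : Set X} {t : ℝ} (h : CoverLowerBound A t) :
    (t : EReal) ≤ lowerBoxDim A := by
  refine EReal.ge_of_forall_gt_iff_ge.1 fun z hz => ?_
  have hz' : z < t := by exact_mod_cast hz
  obtain ⟨u, hu1, hu2⟩ := exists_between hz'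
  obtain ⟨c, hc, ε₀, hε₀, H⟩ := h u hu2
  refine le_liminf_of_le (by isBoundedDefault) ?_
  have hlog := tendsto_neg_log_nhdsGT_zero.eventually_ge_atTop
    (max 1 (max (1 - Real.log ε₀) (-Real.log c / (u - z))))
  filter_upwards [hlog, self_mem_nhdsWithin] with ε hε hpos
  have hpos : (0 : ℝ) < ε := NNReal.coe_pos.2 hpos
  have h1 : 1 ≤ -Real.log ε := (le_max_left _ _).trans hε
  have h2 : -Real.log c ≤ -Real.log ε * (u - z) :=
    (div_le_iff₀ (by linarith)).1 (((le_max_right _ _).trans (le_max_right _ _)).trans hε)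
  have h4 : 1 - Real.log ε₀ ≤ -Real.log ε := ((le_max_left _ _).trans (le_max_right _ _)).trans hε
  have hlt : (ε : ℝ) < ε₀ := (Real.log_lt_log_iff hpos hε₀).1 (by linarith)
  have hpow : 0 < (ε : ℝ) ^ (-u) := Real.rpow_pos_of_pos hpos _
  have h3 : ((z * -Real.log ε : ℝ) : EReal) ≤
      ENNReal.log (Metric.externalCoveringNumber ε A : ℝ≥0∞) := by
    refine le_trans ?_
      (ENNReal.log_monotone (le_externalCoveringNumber_of_covers (H ε hpos hlt)))
    rw [ENNReal.log_ofReal_of_pos (by positivity), Real.log_mul (by positivity) hpow.ne',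
      Real.log_rpow hpos]
    exact_mod_cast (by linarith)
  unfold boxRatio
  rw [EReal.le_div_iff_mul_le (by exact_mod_cast (by linarith)) (EReal.coe_ne_top _)]
  exact_mod_cast h3

lemma lowerBoxDim_le_upperBoxDim (A : Set X) : lowerBoxDim A ≤ upperBoxDim A :=
  liminf_le_limsup

lemma hasBoxDim_of_coverBound {A : Set X} {t : ℝ} (h1 : CoverBound A t)
    (h2 : CoverLowerBound A t) : HasBoxDim A t :=
  ⟨le_antisymm ((lowerBoxDim_le_upperBoxDim A).trans (upperBoxDim_le_of_coverBound h1))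
      (le_lowerBoxDim_of_coverLowerBound h2),
    le_antisymm (upperBoxDim_le_of_coverBound h1)
      ((le_lowerBoxDim_of_coverLowerBound h2).trans (lowerBoxDim_le_upperBoxDim A))⟩

end CoveringBounds

/-! ### Packing dimension is bounded by covering exponents -/

section PackingUpper

variable {X : Type*} [PseudoMetricSpace X]

/-- Each covering ball contains at most one centre: two centres in it are within `2 * ε`, so one
would lie in the packing ball of the other, against disjointness. -/
lemma IsPacking.card_le_of_covers {δ : ℝ} {F : Set X} {P : Set (X × ℝ)} (hP : IsPacking δ F P)
    {ε N : ℝ} (hF : Covers F ε N) (G : Finset P) (hG : ∀ p ∈ G, 2 * ε ≤ p.1.2) :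
    (G.card : ℝ) ≤ N := by
  classical
  obtain ⟨C, hC, hcov⟩ := hF
  have hex : ∀ p : P, ∃ c ∈ C, dist p.1.1 c ≤ ε := fun p => by
    obtain ⟨c, hc, hpc⟩ := mem_iUnion₂.1 (hcov (hP.1 p.1 p.2).1)
    exact ⟨c, hc, hpc⟩
  choose f hf hfd using hex
  have hcard : G.card ≤ C.card := by
    refine Finset.card_le_card_of_injOn f (fun p _ => hf p) ?_
    intro p hp q hq hpq
    by_contra hne
    have hne' : p.1 ≠ q.1 := fun h => hne (Subtype.ext h)
    have hdis := hP.2 p.2 q.2 hne'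
    refine Set.disjoint_left.1 hdis (?_ : q.1.1 ∈ _)
      (Metric.mem_closedBall_self (hP.1 q.1 q.2).2.1.le)
    have h1 := hfd p
    have h2 := hfd q
    rw [← hpq] at h2
    have := dist_triangle_right q.1.1 p.1.1 (f p)
    have := hG p hp
    rw [Metric.mem_closedBall]
    linarith
  exact (by exact_mod_cast hcard : (G.card : ℝ) ≤ C.card).trans hC

lemma packingMeasure_le_packingPremeasure (s : ℝ≥0) (F : Set X) :
    packingMeasure s F ≤ packingPremeasure s F := by
  have hempty : packingPremeasure s (∅ : Set X) = 0 := by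
    refine le_antisymm ((iInf₂_le (1 : ℝ) one_pos).trans ?_) bot_le
    refine iSup₂_le fun P hP => ?_
    have : P = ∅ := Set.eq_empty_of_forall_notMem fun p hp => (hP.1 p hp).1
    subst this
    simp
  refine (iInf₂_le (fun i : ℕ => if i = 0 then F else ∅)
    (fun x hx => mem_iUnion.2 ⟨0, by simpa using hx⟩)).trans ?_
  rw [tsum_eq_single 0]
  · simp
  · intro i hi
    simp [hi, hempty]

lemma exists_dyadic {r : ℝ} (h0 : 0 < r) (h1 : r ≤ 1) :
    ∃ m : ℕ, (1 / 2 : ℝ) ^ (m + 1) < r ∧ r ≤ (1 / 2 : ℝ) ^ m := by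
  exact exists_nat_pow_near_of_lt_one h0 h1 (by norm_num) (by norm_num)

/-- Sort the balls by dyadic radius. The shell at `2⁻ⁱ` holds at most `C * 2 ^ ((i + 2) * u)` balls
of weight at most `2 ^ (-i * v)`, so the shells are dominated by a geometric series of ratio `2 ^ (u
- v)`, uniformly in the packing. -/
lemma exists_tsum_radius_rpow_le {F : Set X} {u v C : ℝ} (hu : 0 ≤ u) (huv : u < v)
    (hC : ∀ ε : ℝ, 0 < ε → ε ≤ 1 → Covers F ε (C * ε ^ (-u))) :
    ∃ K : ℝ≥0∞, K ≠ ⊤ ∧ ∀ P : Set (X × ℝ), IsPacking 1 F P →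
      ∑' p : P, ENNReal.ofReal p.1.2 ^ v ≤ K := by
  classical
  have hC0 : 0 ≤ C := by simpa using (hC 1 one_pos le_rfl).nonneg
  set q : ℝ := (1 / 2 : ℝ) ^ (v - u) with hq
  have hq0 : 0 < q := Real.rpow_pos_of_pos (by norm_num) _
  have hq1 : q < 1 := Real.rpow_lt_one (by norm_num) (by norm_num) (by linarith)
  set g : ℕ → ℝ := fun m => C * (1 / 2 : ℝ) ^ (-(2 * u)) * q ^ m with hg
  have hgs : Summable g := (summable_geometric_of_lt_one hq0.le hq1).mul_left _
  have hg0 : ∀ m, 0 ≤ g m := fun m => by positivity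
  refine ⟨∑' m, ENNReal.ofReal (g m), hgs.tsum_ofReal_ne_top, fun P hP => ?_⟩
  have hlev : ∀ p : P, ∃ m : ℕ, (1 / 2 : ℝ) ^ (m + 1) < p.1.2 ∧ p.1.2 ≤ (1 / 2 : ℝ) ^ m :=
    fun p => exists_dyadic (hP.1 p.1 p.2).2.1 (hP.1 p.1 p.2).2.2
  choose m hm1 hm2 using hlev
  have hv : 0 < v := hu.trans_lt huv
  calc ∑' p : P, ENNReal.ofReal p.1.2 ^ v
      ≤ ∑' p : P, ∑' i : ℕ, if i = m p then ENNReal.ofReal (((1 / 2 : ℝ) ^ i) ^ v) else 0 := by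
        refine ENNReal.tsum_le_tsum fun p => ?_
        rw [tsum_ite_eq, ENNReal.ofReal_rpow_of_nonneg (hP.1 p.1 p.2).2.1.le hv.le]
        exact ENNReal.ofReal_le_ofReal
          (Real.rpow_le_rpow (hP.1 p.1 p.2).2.1.le (hm2 p) hv.le)
    _ = ∑' i : ℕ, ∑' p : P, if i = m p then ENNReal.ofReal (((1 / 2 : ℝ) ^ i) ^ v) else 0 :=
        ENNReal.tsum_comm
    _ ≤ ∑' i, ENNReal.ofReal (g i) := by
        refine ENNReal.tsum_le_tsum fun i => ?_
        rw [ENNReal.tsum_eq_iSup_sum]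
        refine iSup_le fun G => ?_
        rw [← Finset.sum_filter, Finset.sum_const, nsmul_eq_mul]
        -- The scale `2 ^ (-(i + 2))` is half the lower end of the shell, as the counting lemma
        -- requires.
        have hcard := hP.card_le_of_covers
          (hC ((1 / 2 : ℝ) ^ (i + 2)) (by positivity) (pow_le_one₀ (by norm_num) (by norm_num)))
          (G.filter (fun p => i = m p)) (fun p hp => by
            have := hm1 p
            rw [← (Finset.mem_filter.1 hp).2] at this
            rw [pow_succ]
            linarith)
        rw [← ENNReal.ofReal_natCast, ← ENNReal.ofReal_mul (by positivity)]
        refine ENNReal.ofReal_le_ofReal ?_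
        refine (mul_le_mul_of_nonneg_right hcard (by positivity)).trans (le_of_eq ?_)
        have h12 : (0 : ℝ) < 1 / 2 := by norm_num
        rw [hg, hq]
        simp only
        rw [← Real.rpow_natCast, ← Real.rpow_natCast, ← Real.rpow_natCast, ← Real.rpow_mul h12.le,
          ← Real.rpow_mul h12.le, ← Real.rpow_mul h12.le, mul_assoc, mul_assoc,
          ← Real.rpow_add h12, ← Real.rpow_add h12]
        congr 2
        push_cast
        ring

/-- With `v` strictly between `u` and `s`, write `r ^ s = r ^ (s - v) * r ^ v`. The second factors
have uniformly bounded sum and the first are at most `δ ^ (s - v)`, which tends to `0`. -/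
lemma packingPremeasure_eq_zero {F : Set X} {u C : ℝ} {s : ℝ≥0} (hu : 0 ≤ u) (hus : u < s)
    (hC : ∀ ε : ℝ, 0 < ε → ε ≤ 1 → Covers F ε (C * ε ^ (-u))) :
    packingPremeasure s F = 0 := by
  obtain ⟨v, huv, hvs⟩ := exists_between hus
  obtain ⟨K, hK, H⟩ := exists_tsum_radius_rpow_le hu huv hC
  have hv0 : 0 < v := hu.trans_lt huv
  have key : ∀ δ : ℝ, 0 < δ → δ ≤ 1 → packingPremeasure s F ≤
      ENNReal.ofReal (2 ^ (s : ℝ)) * ENNReal.ofReal (δ ^ ((s : ℝ) - v)) * K := by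
    intro δ hδ hδ1
    refine (iInf₂_le δ hδ).trans (iSup₂_le fun P hP => ?_)
    have hP1 : IsPacking 1 F P :=
      ⟨fun p hp => ⟨(hP.1 p hp).1, (hP.1 p hp).2.1, (hP.1 p hp).2.2.trans hδ1⟩, hP.2⟩
    calc ∑' p : P, ENNReal.ofReal (2 * p.1.2) ^ (s : ℝ)
        ≤ ∑' p : P, ENNReal.ofReal (2 ^ (s : ℝ)) * ENNReal.ofReal (δ ^ ((s : ℝ) - v)) *
            ENNReal.ofReal p.1.2 ^ v := by
          refine ENNReal.tsum_le_tsum fun p => ?_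
          have hr := (hP.1 p.1 p.2).2.1
          have hrδ := (hP.1 p.1 p.2).2.2
          rw [ENNReal.ofReal_rpow_of_nonneg (by positivity) (by positivity),
            ENNReal.ofReal_rpow_of_nonneg hr.le hv0.le, ← ENNReal.ofReal_mul (by positivity),
            ← ENNReal.ofReal_mul (by positivity)]
          refine ENNReal.ofReal_le_ofReal ?_
          rw [Real.mul_rpow (by norm_num) hr.le, mul_assoc]
          refine mul_le_mul_of_nonneg_left ?_ (by positivity)
          calc p.1.2 ^ (s : ℝ) = p.1.2 ^ ((s : ℝ) - v) * p.1.2 ^ v := by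
                rw [← Real.rpow_add hr]; ring_nf
            _ ≤ _ := mul_le_mul_of_nonneg_right
                (Real.rpow_le_rpow hr.le hrδ (by linarith)) (by positivity)
      _ ≤ _ := by
          rw [ENNReal.tsum_mul_left]
          exact mul_le_mul_right (H P hP1) _
  have hlim : Tendsto (fun δ : ℝ =>
      ENNReal.ofReal (2 ^ (s : ℝ)) * ENNReal.ofReal (δ ^ ((s : ℝ) - v)) * K) (𝓝[>] 0) (𝓝 0) := by
    have h1 : Tendsto (fun δ : ℝ => δ ^ ((s : ℝ) - v)) (𝓝[>] 0) (𝓝 0) := by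
      have := (Real.continuousAt_rpow_const 0 ((s : ℝ) - v) (Or.inr (by linarith))).tendsto
      rw [Real.zero_rpow (by linarith)] at this
      exact this.mono_left nhdsWithin_le_nhds
    have h2 := ENNReal.tendsto_ofReal h1
    rw [ENNReal.ofReal_zero] at h2
    have h3 := ENNReal.Tendsto.const_mul (a := ENNReal.ofReal (2 ^ (s : ℝ))) h2
      (Or.inr ENNReal.ofReal_ne_top)
    have h4 := ENNReal.Tendsto.mul_const (b := K) h3 (Or.inr hK)
    simpa using h4
  refine le_antisymm (ge_of_tendsto hlim ?_) bot_le
  filter_upwards [Ioc_mem_nhdsGT (one_pos : (0 : ℝ) < 1)] with δ hδ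
  exact key δ hδ.1 hδ.2

lemma packingDim_le_of_coverBound {F : Set X} {t : ℝ} (ht : 0 ≤ t) (h : CoverBound F t) :
    packingDim F ≤ ENNReal.ofReal t := by
  refine le_of_forall_gt_imp_ge_of_dense fun a ha => ?_
  obtain ⟨s, hs1, hs2⟩ := ENNReal.lt_iff_exists_nnreal_btwn.1 ha
  have hts : t < s := by
    rw [← ENNReal.ofReal_coe_nnreal] at hs1
    exact ENNReal.ofReal_lt_ofReal_iff_of_nonneg ht |>.1 hs1
  obtain ⟨u, hu1, hu2⟩ := exists_between hts
  obtain ⟨C, hC⟩ := h u hu1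
  refine (iInf₂_le s ?_).trans hs2.le
  exact le_antisymm ((packingMeasure_le_packingPremeasure s F).trans
    (packingPremeasure_eq_zero (ht.trans hu1.le) hu2 hC).le) bot_le

end PackingUpper

/-! ### Hausdorff dimension as a lower bound for box and packing dimension -/

section HausdorffLower

open MeasureTheory

variable {X : Type*} [MetricSpace X]

lemma exists_packing_covering (F : Set X) {δ : ℝ} (hδ : 0 < δ) :
    ∃ M ⊆ F, (M.PairwiseDisjoint fun x => Metric.closedBall x δ) ∧
      F ⊆ ⋃ x ∈ M, Metric.closedBall x (5 * δ) := by
  obtain ⟨M, hMF, hdis, hcov⟩ := Vitali.exists_disjoint_subfamily_covering_enlargement_closedBall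
    F (fun x : X => x) (fun _ => δ) δ (fun _ _ => le_rfl) 5 (by norm_num)
  refine ⟨M, hMF, hdis, fun x hx => ?_⟩
  obtain ⟨b, hb, hsub⟩ := hcov x hx
  exact mem_iUnion₂.2 ⟨b, hb, hsub (Metric.mem_closedBall_self hδ.le)⟩

lemma ediam_closedBall_rpow_le (x : X) {r : ℝ} (hr : 0 ≤ r) {s : ℝ} (hs : 0 ≤ s) :
    Metric.ediam (Metric.closedBall x r) ^ s ≤ ENNReal.ofReal (2 * r) ^ s := by
  refine ENNReal.rpow_le_rpow ?_ hs
  rw [← Metric.closedEBall_ofReal hr]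
  refine Metric.ediam_closedEBall_le.trans (le_of_eq ?_)
  rw [ENNReal.ofReal_mul (by norm_num)]
  simp

lemma tendsto_radii (c : ℝ) :
    Tendsto (fun n : ℕ => ENNReal.ofReal (c * (1 / ((n : ℝ) + 1)))) atTop (𝓝 0) := by
  have h := ENNReal.tendsto_ofReal ((tendsto_one_div_add_atTop_nhds_zero_nat (𝕜 := ℝ)).const_mul c)
  simpa using h

variable [MeasurableSpace X] [BorelSpace X]

/-- If the bound failed for some `u ≥ 0`, there would be arbitrarily fine covers by fewer than `ε ^
(-u)` balls, making the `u`-dimensional Hausdorff measure at most `2 ^ u`; but it is infinite for `u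
< dimH F`. -/
lemma coverLowerBound_of_le_dimH {F : Set X} (hne : F.Nonempty) {t : ℝ}
    (h : ENNReal.ofReal t ≤ dimH F) : CoverLowerBound F t := by
  intro u hu
  refine ⟨1, one_pos, ?_⟩
  -- For negative `u` the claimed bound is at most `1`, and a nonempty set needs at least one ball.
  rcases lt_or_ge u 0 with hu0 | hu0
  · refine ⟨1, one_pos, fun ε h0 h1 N hN => ?_⟩
    obtain ⟨C, hC, hcov⟩ := hN
    obtain ⟨x, hx⟩ := hne
    obtain ⟨y, hy, -⟩ := mem_iUnion₂.1 (hcov hx)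
    have hcard : (1 : ℝ) ≤ C.card := by exact_mod_cast Finset.card_pos.2 ⟨y, hy⟩
    have := Real.rpow_le_one h0.le h1.le (by linarith : 0 ≤ -u)
    linarith
  · by_contra! hcon
    have hlt : ((u.toNNReal : ℝ≥0) : ℝ≥0∞) < dimH F :=
      (ENNReal.ofReal_lt_ofReal_iff_of_nonneg hu0).2 hu |>.trans_le h
    have htop := hausdorffMeasure_of_lt_dimH hlt
    rw [Real.coe_toNNReal _ hu0] at htop
    choose ε hε0 hε1 N hN hNlt using fun n : ℕ =>
      hcon (1 / ((n : ℝ) + 1)) (by positivity)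
    choose C hC hcov using hN
    have hH := Measure.hausdorffMeasure_le_liminf_tsum u F (l := atTop)
      (fun n : ℕ => ENNReal.ofReal (2 * (1 / ((n : ℝ) + 1)))) (tendsto_radii 2)
      (fun n (x : C n) => Metric.closedBall x.1 (ε n))
      (Eventually.of_forall fun n x => by
        have := ediam_closedBall_rpow_le x.1 (hε0 n).le zero_le_one
        rw [ENNReal.rpow_one, ENNReal.rpow_one] at this
        refine this.trans (ENNReal.ofReal_le_ofReal ?_)
        linarith [hε1 n])
      (Eventually.of_forall fun n => by
        intro x hx
        obtain ⟨y, hy, hxy⟩ := mem_iUnion₂.1 (hcov n hx)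
        exact mem_iUnion.2 ⟨⟨y, hy⟩, hxy⟩)
    rw [htop] at hH
    have hle : liminf (fun n => ∑' x : C n, Metric.ediam (Metric.closedBall x.1 (ε n)) ^ u)
        atTop ≤ ENNReal.ofReal (2 ^ u) := by
      refine liminf_le_of_frequently_le' (Eventually.frequently (Eventually.of_forall fun n => ?_))
      have hterm : ENNReal.ofReal (2 * ε n) ^ u = ENNReal.ofReal ((2 * ε n) ^ u) :=
        ENNReal.ofReal_rpow_of_nonneg (by linarith [hε0 n]) hu0
      have hpow : (0 : ℝ) < ε n ^ u := Real.rpow_pos_of_pos (hε0 n) _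
      calc ∑' x : C n, Metric.ediam (Metric.closedBall x.1 (ε n)) ^ u
          ≤ ∑' _ : C n, ENNReal.ofReal ((2 * ε n) ^ u) := by
            refine ENNReal.tsum_le_tsum fun x => ?_
            rw [← hterm]
            exact ediam_closedBall_rpow_le x.1 (hε0 n).le hu0
        _ = ENNReal.ofReal ((C n).card * (2 * ε n) ^ u) := by
            rw [tsum_fintype, Finset.sum_const, nsmul_eq_mul,
              ENNReal.ofReal_mul (Nat.cast_nonneg _), ENNReal.ofReal_natCast]
            simp
        _ ≤ _ := by
            refine ENNReal.ofReal_le_ofReal ?_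
            have h1 : ((C n).card : ℝ) ≤ (ε n ^ u)⁻¹ := by
              have := (hC n).trans (hNlt n).le
              rwa [one_mul, Real.rpow_neg (hε0 n).le] at this
            rw [Real.mul_rpow (by norm_num) (hε0 n).le]
            have h2 : ((C n).card : ℝ) * ε n ^ u ≤ 1 := by
              rw [inv_eq_one_div, le_div_iff₀ hpow] at h1
              exact h1
            have h3 : (0 : ℝ) < 2 ^ u := by positivity
            nlinarith
    exact absurd (hH.trans hle) (by simp)

variable [SecondCountableTopology X]

/-- By Vitali, one family of centres serves both sides: the balls of radius `e` form a packing while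
those of radius `5 * e` cover. -/
lemma hausdorffMeasure_le_packingPremeasure (s : ℝ≥0) (F : Set X) :
    μH[(s : ℝ)] F ≤ 5 ^ (s : ℝ) * packingPremeasure s F := by
  have hδ : ∀ n : ℕ, (0 : ℝ) < 1 / ((n : ℝ) + 1) := fun n => by positivity
  choose M hMF hdis hcov using fun n : ℕ => exists_packing_covering F (hδ n)
  have hcount : ∀ n, Countable (M n) := fun n =>
    ((hdis n).countable_of_nonempty_interior fun x _ => by
      refine ⟨x, ?_⟩
      exact Metric.ball_subset_interior_closedBall (Metric.mem_ball_self (hδ n))).to_subtype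
  have hH := Measure.hausdorffMeasure_le_liminf_tsum (s : ℝ) F (l := atTop)
    (fun n : ℕ => ENNReal.ofReal (10 * (1 / ((n : ℝ) + 1)))) (tendsto_radii 10)
    (fun n (x : M n) => Metric.closedBall x.1 (5 * (1 / ((n : ℝ) + 1))))
    (Eventually.of_forall fun n x => by
      have := ediam_closedBall_rpow_le x.1 (r := 5 * (1 / ((n : ℝ) + 1))) (by positivity)
        zero_le_one
      rw [ENNReal.rpow_one, ENNReal.rpow_one] at this
      refine this.trans (ENNReal.ofReal_le_ofReal (by linarith)))
    (Eventually.of_forall fun n => by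
      rw [iUnion_coe_set]
      exact hcov n)
  refine hH.trans ?_
  rw [packingPremeasure, ENNReal.mul_iInf_of_ne (by simp) (by simp)]
  refine le_iInf fun δ => ?_
  rw [ENNReal.mul_iInf_of_ne (by simp) (by simp)]
  refine le_iInf fun hδ0 => ?_
  refine liminf_le_of_frequently_le' (Eventually.frequently ?_)
  have hev := (tendsto_one_div_add_atTop_nhds_zero_nat (𝕜 := ℝ)).eventually_lt_const hδ0
  filter_upwards [hev] with n hn
  set e : ℝ := 1 / ((n : ℝ) + 1) with he
  have he0 : 0 < e := hδ n
  let P : Set (X × ℝ) := (fun x => (x, e)) '' M n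
  have hinj : Function.Injective (fun x : X => (x, e)) := fun x y h => (Prod.ext_iff.1 h).1
  have hP : IsPacking δ F P := by
    constructor
    · rintro _ ⟨x, hx, rfl⟩
      exact ⟨hMF n hx, he0, hn.le⟩
    · rintro _ ⟨x, hx, rfl⟩ _ ⟨y, hy, rfl⟩ hxy
      exact hdis n hx hy fun h => hxy (by rw [h])
  calc ∑' x : M n, Metric.ediam (Metric.closedBall x.1 (5 * e)) ^ (s : ℝ)
      ≤ ∑' x : M n, 5 ^ (s : ℝ) * ENNReal.ofReal (2 * e) ^ (s : ℝ) := by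
        refine ENNReal.tsum_le_tsum fun x => ?_
        refine (ediam_closedBall_rpow_le x.1 (by positivity) s.coe_nonneg).trans (le_of_eq ?_)
        rw [← ENNReal.mul_rpow_of_nonneg _ _ s.coe_nonneg, show (2 * (5 * e)) = 5 * (2 * e) by ring,
          ENNReal.ofReal_mul (by norm_num)]
        simp
    _ = 5 ^ (s : ℝ) * ∑' x : M n, ENNReal.ofReal (2 * e) ^ (s : ℝ) := ENNReal.tsum_mul_left
    _ = 5 ^ (s : ℝ) * ∑' p : P, ENNReal.ofReal (2 * p.1.2) ^ (s : ℝ) := by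
        rw [tsum_image (fun p : X × ℝ => ENNReal.ofReal (2 * p.2) ^ (s : ℝ)) hinj.injOn]
    _ ≤ _ := mul_le_mul_right (le_iSup₂ (f := fun (P : Set (X × ℝ)) (_ : IsPacking δ F P) =>
        ∑' p : P, ENNReal.ofReal (2 * p.1.2) ^ (s : ℝ)) P hP) _

lemma dimH_le_packingDim (F : Set X) : dimH F ≤ packingDim F := by
  refine le_iInf₂ fun s hs => ?_
  by_contra! hlt
  have htop := hausdorffMeasure_of_lt_dimH hlt
  have hle : μH[(s : ℝ)] F ≤ 5 ^ (s : ℝ) * packingMeasure s F := by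
    rw [packingMeasure, ENNReal.mul_iInf_of_ne (by simp) (by simp)]
    refine le_iInf fun t => ?_
    rw [ENNReal.mul_iInf_of_ne (by simp) (by simp)]
    refine le_iInf fun ht => ?_
    calc μH[(s : ℝ)] F ≤ μH[(s : ℝ)] (⋃ i, t i) := measure_mono ht
      _ ≤ ∑' i, μH[(s : ℝ)] (t i) := measure_iUnion_le _
      _ ≤ ∑' i, 5 ^ (s : ℝ) * packingPremeasure s (t i) :=
          ENNReal.tsum_le_tsum fun i => hausdorffMeasure_le_packingPremeasure s (t i)
      _ = _ := ENNReal.tsum_mul_left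
  rw [hs, htop] at hle
  simp at hle

end HausdorffLower

/-! ### Block digit expansions -/

section Digits

/-- The triangular number `0 + 1 + ⋯ + (J - 1)`. -/
def tri (J : ℕ) : ℕ := ∑ j ∈ Finset.range J, j

lemma tri_succ (J : ℕ) : tri (J + 1) = tri J + J := Finset.sum_range_succ _ _

@[simp] lemma tri_zero : tri 0 = 0 := rfl

lemma tri_mono : Monotone tri := monotone_nat_of_le_succ fun J => by rw [tri_succ]; omega

lemma tri_cast (J : ℕ) : (tri J : ℝ) = J * (J - 1) / 2 := by
  induction J with
  | zero => simp
  | succ J ih => rw [tri_succ]; push_cast; rw [ih]; ring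

lemma le_tri_succ (J : ℕ) : J ≤ tri (J + 1) := by rw [tri_succ]; omega

lemma tendsto_tri : Tendsto tri atTop atTop := by
  rw [← tendsto_add_atTop_iff_nat 1]
  exact tendsto_atTop_mono le_tri_succ tendsto_id

/-- Since `tri M` is quadratic, terms linear in `M` are negligible. This absorbs both the ratio `b ^
M` of consecutive scales and a constant factor per digit. -/
lemma exists_le_mul_tri_add {η : ℝ} (hη : 0 < η) :
    ∃ C : ℝ, 0 ≤ C ∧ ∀ M : ℕ, (M : ℝ) ≤ η * tri M + C := by
  -- The constant comes from completing the square in `η * M * (M - 1) / 2 - M`.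
  refine ⟨η / 2 * ((η / 2 + 1) / η) ^ 2, by positivity, fun M => ?_⟩
  rw [tri_cast]
  have h : 0 ≤ η / 2 * ((M : ℝ) - (η / 2 + 1) / η) ^ 2 := by positivity
  have h2 : η / 2 * ((M : ℝ) - (η / 2 + 1) / η) ^ 2 =
      η / 2 * (M : ℝ) ^ 2 - (η / 2 + 1) * M + η / 2 * ((η / 2 + 1) / η) ^ 2 := by
    field_simp
    ring
  nlinarith

/-- The real number with digits `e j` at the places `b ^ tri (j + 1)`. -/
def digitSum (b : ℝ) (e : ℕ → ℤ) : ℝ := ∑' j, (e j : ℝ) * b ^ tri (j + 1)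

/-- The set of all numbers whose `j`-th digit belongs to `E j`. -/
def digitSet (b : ℝ) (E : ℕ → Finset ℤ) : Set ℝ := digitSum b '' {e | ∀ j, e j ∈ E j}

/-- The digit sequence `e` is bounded by `c * (2 ^ j - 1)`. -/
def DigitBound (c : ℝ) (e : ℕ → ℤ) : Prop := ∀ j, |(e j : ℝ)| ≤ c * (2 ^ j - 1)

variable {b : ℝ}

lemma tendsto_pow_tri (h0 : 0 < b) (h1 : b ≤ 1 / 2) :
    Tendsto (fun J => b ^ tri J) atTop (𝓝 0) :=
  (tendsto_pow_atTop_nhds_zero_of_lt_one h0.le (by linarith)).comp tendsto_tri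

lemma hasSum_pow_tri_sub (h0 : 0 < b) (h1 : b ≤ 1 / 2) (J : ℕ) :
    HasSum (fun j => b ^ tri (j + J) - b ^ tri (j + J + 1)) (b ^ tri J) := by
  rw [hasSum_iff_tendsto_nat_of_nonneg]
  · have h : ∀ n, ∑ i ∈ Finset.range n, (b ^ tri (i + J) - b ^ tri (i + J + 1)) =
        b ^ tri J - b ^ tri (n + J) := fun n => by
      have := Finset.sum_range_sub' (fun i => b ^ tri (i + J)) n
      simp only [zero_add] at this
      rw [← this]
      refine Finset.sum_congr rfl fun i _ => ?_
      rw [show i + 1 + J = i + J + 1 by ring]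
    simp only [h]
    have h2 := ((tendsto_add_atTop_iff_nat J).2 (tendsto_pow_tri h0 h1)).const_sub (b ^ tri J)
    simpa using h2
  · intro j
    rw [sub_nonneg]
    exact pow_le_pow_of_le_one h0.le (by linarith) (tri_mono (Nat.le_succ _))

/-- The telescoping majorant behind every tail estimate. Its factor `2 * b` is at most `1`, and
strictly less when `b < 1 / 2`, so that the first differing digit then dominates the tail. -/
lemma digit_term_le (h0 : 0 < b) (h1 : b ≤ 1 / 2) (j : ℕ) :
    (2 ^ j - 1) * b ^ tri (j + 1) ≤ 2 * b * (b ^ tri j - b ^ tri (j + 1)) := by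
  rcases Nat.eq_zero_or_pos j with rfl | hj
  · simp [tri_succ]
  rw [tri_succ, pow_add]
  have hp : 0 < b ^ tri j := by positivity
  have hbj : 0 < b ^ j := by positivity
  have h3 : (2 * b) ^ j ≤ 2 * b := pow_le_of_le_one (by linarith) (by linarith) (by omega)
  rw [mul_pow] at h3
  have h4 : (2 ^ j - 1) * b ^ j ≤ 2 * b * (1 - b ^ j) := by nlinarith
  calc (2 ^ j - 1) * (b ^ tri j * b ^ j) = b ^ tri j * ((2 ^ j - 1) * b ^ j) := by ring
    _ ≤ b ^ tri j * (2 * b * (1 - b ^ j)) := mul_le_mul_of_nonneg_left h4 hp.le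
    _ = _ := by ring

lemma DigitBound.abs_term_le {c : ℝ} (hc : 0 ≤ c) {e : ℕ → ℤ} (he : DigitBound c e)
    (h0 : 0 < b) (h1 : b ≤ 1 / 2) (j : ℕ) :
    |(e j : ℝ) * b ^ tri (j + 1)| ≤ c * (2 * b) * (b ^ tri j - b ^ tri (j + 1)) := by
  rw [abs_mul, abs_of_pos (pow_pos h0 _)]
  calc |(e j : ℝ)| * b ^ tri (j + 1) ≤ c * (2 ^ j - 1) * b ^ tri (j + 1) :=
        mul_le_mul_of_nonneg_right (he j) (by positivity)
    _ = c * ((2 ^ j - 1) * b ^ tri (j + 1)) := by ring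
    _ ≤ c * (2 * b * (b ^ tri j - b ^ tri (j + 1))) :=
        mul_le_mul_of_nonneg_left (digit_term_le h0 h1 j) hc
    _ = _ := by ring

lemma DigitBound.summable {c : ℝ} (hc : 0 ≤ c) {e : ℕ → ℤ} (he : DigitBound c e)
    (h0 : 0 < b) (h1 : b ≤ 1 / 2) : Summable fun j => (e j : ℝ) * b ^ tri (j + 1) :=
  Summable.of_norm_bounded ((hasSum_pow_tri_sub h0 h1 0).summable.mul_left (c * (2 * b)))
    fun j => he.abs_term_le hc h0 h1 j

lemma DigitBound.abs_tail_le {c : ℝ} (hc : 0 ≤ c) {e : ℕ → ℤ} (he : DigitBound c e)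
    (h0 : 0 < b) (h1 : b ≤ 1 / 2) (J : ℕ) :
    |∑' j, (e (j + J) : ℝ) * b ^ tri (j + J + 1)| ≤ c * (2 * b) * b ^ tri J := by
  have := tsum_of_norm_bounded ((hasSum_pow_tri_sub h0 h1 J).mul_left (c * (2 * b)))
    (f := fun j => (e (j + J) : ℝ) * b ^ tri (j + J + 1))
    fun j => he.abs_term_le hc h0 h1 (j + J)
  exact this

lemma DigitBound.digitSum_eq {c : ℝ} (hc : 0 ≤ c) {e : ℕ → ℤ} (he : DigitBound c e)
    (h0 : 0 < b) (h1 : b ≤ 1 / 2) (J : ℕ) :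
    digitSum b e = ∑ j ∈ Finset.range J, (e j : ℝ) * b ^ tri (j + 1) +
      ∑' j, (e (j + J) : ℝ) * b ^ tri (j + J + 1) :=
  ((he.summable hc h0 h1).sum_add_tsum_nat_add J).symm

lemma DigitBound.abs_digitSum_le {c : ℝ} (hc : 0 ≤ c) {e : ℕ → ℤ} (he : DigitBound c e)
    (h0 : 0 < b) (h1 : b ≤ 1 / 2) : |digitSum b e| ≤ c := by
  have := he.abs_tail_le hc h0 h1 0
  simp only [add_zero, tri_zero, pow_zero, mul_one] at this
  exact this.trans (by nlinarith)

lemma DigitBound.digitSum_add {c d : ℝ} (hc : 0 ≤ c) (hd : 0 ≤ d) {e f : ℕ → ℤ}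
    (he : DigitBound c e) (hf : DigitBound d f) (h0 : 0 < b) (h1 : b ≤ 1 / 2) :
    digitSum b (fun j => e j + f j) = digitSum b e + digitSum b f := by
  rw [digitSum, digitSum, digitSum, ← (he.summable hc h0 h1).tsum_add (hf.summable hd h0 h1)]
  refine tsum_congr fun j => ?_
  push_cast
  ring

lemma DigitBound.digitSum_sub {c d : ℝ} (hc : 0 ≤ c) (hd : 0 ≤ d) {e f : ℕ → ℤ}
    (he : DigitBound c e) (hf : DigitBound d f) (h0 : 0 < b) (h1 : b ≤ 1 / 2) :
    digitSum b (fun j => e j - f j) = digitSum b e - digitSum b f := by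
  rw [digitSum, digitSum, digitSum, ← (he.summable hc h0 h1).tsum_sub (hf.summable hd h0 h1)]
  refine tsum_congr fun j => ?_
  push_cast
  ring

lemma isCompact_digitSet {c : ℝ} (hc : 0 ≤ c) {E : ℕ → Finset ℤ}
    (hE : ∀ e : ℕ → ℤ, (∀ j, e j ∈ E j) → DigitBound c e)
    (h0 : 0 < b) (h1 : b ≤ 1 / 2) : IsCompact (digitSet b E) := by
  have hK : IsCompact {e : ℕ → ℤ | ∀ j, e j ∈ E j} := by
    have := isCompact_univ_pi (X := fun _ : ℕ => ℤ) (s := fun j => (E j : Set ℤ))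
      fun j => (E j).finite_toSet.isCompact
    convert this using 1
    ext e
    simp
  refine hK.image_of_continuousOn ?_
  refine continuousOn_tsum (u := fun j => c * (2 * b) * (b ^ tri j - b ^ tri (j + 1)))
    (fun j => ?_) ((hasSum_pow_tri_sub h0 h1 0).summable.mul_left (c * (2 * b)))
    fun j e he => (hE e he).abs_term_le hc h0 h1 j
  refine Continuous.continuousOn ?_
  exact ((continuous_of_discreteTopology (f := fun z : ℤ => (z : ℝ))).comp
    (continuous_apply j)).mul continuous_const

/-- The finite sums of the first `M` digits. -/
lemma exists_finset_partial_sums (b : ℝ) (E : ℕ → Finset ℤ) (M : ℕ) :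
    ∃ F : Finset ℝ, F.card ≤ ∏ j ∈ Finset.range M, (E j).card ∧
      ∀ e : ℕ → ℤ, (∀ j, e j ∈ E j) →
        ∑ j ∈ Finset.range M, (e j : ℝ) * b ^ tri (j + 1) ∈ F := by
  classical
  induction M with
  | zero => exact ⟨{0}, by simp, by simp⟩
  | succ M ih =>
    obtain ⟨F, hF, hmem⟩ := ih
    refine ⟨Finset.image₂ (fun x (d : ℤ) => x + (d : ℝ) * b ^ tri (M + 1)) F (E M), ?_, ?_⟩
    · rw [Finset.prod_range_succ]
      exact (Finset.card_image₂_le _ _ _).trans (Nat.mul_le_mul_right _ hF)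
    · intro e he
      rw [Finset.sum_range_succ]
      exact Finset.mem_image₂_of_mem (hmem e he) (he M)

lemma covers_digitSet {E : ℕ → Finset ℤ}
    (hE : ∀ e : ℕ → ℤ, (∀ j, e j ∈ E j) → DigitBound 2 e)
    (h0 : 0 < b) (h1 : b ≤ 1 / 2) (M : ℕ) :
    Covers (digitSet b E) (2 * b ^ tri M) ((∏ j ∈ Finset.range M, (E j).card : ℕ) : ℝ) := by
  obtain ⟨F, hF, hmem⟩ := exists_finset_partial_sums b E M
  refine ⟨F, by exact_mod_cast hF, ?_⟩
  rintro _ ⟨e, he, rfl⟩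
  refine mem_iUnion₂.2 ⟨_, hmem e he, ?_⟩
  rw [Metric.mem_closedBall, Real.dist_eq, (hE e he).digitSum_eq zero_le_two h0 h1 M,
    add_sub_cancel_left]
  refine ((hE e he).abs_tail_le zero_le_two h0 h1 M).trans ?_
  have : 0 < b ^ tri M := by positivity
  nlinarith

end Digits

/-! ### Full and gapped digit sets, and the common radius -/

section DigitFamilies

open scoped Classical in
/-- All digits `0, …, 2 ^ j - 1` at the places in `H`, and `0` elsewhere. -/
def stdDigits (H : Set ℕ) (j : ℕ) : Finset ℤ := if j ∈ H then Finset.Icc 0 (2 ^ j - 1) else {0}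

open scoped Classical in
/-- Signed digits at the places of `H` that are not congruent to `i` modulo `p`,
and `0` elsewhere. -/
def gapDigits (p : ℕ) (H : Set ℕ) (i j : ℕ) : Finset ℤ :=
  if j ∈ H ∧ j % p ≠ i then Finset.Icc (-(2 * (2 ^ j - 1))) (2 * (2 ^ j - 1)) else {0}

lemma zero_le_two_pow_sub_one (j : ℕ) : (0 : ℝ) ≤ 2 ^ j - 1 :=
  sub_nonneg.2 (one_le_pow₀ one_le_two)

lemma digitBound_stdDigits {H : Set ℕ} {e : ℕ → ℤ} (he : ∀ j, e j ∈ stdDigits H j) :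
    DigitBound 1 e := fun j => by
  have h := he j
  have h0 := zero_le_two_pow_sub_one j
  unfold stdDigits at h
  split_ifs at h
  · rw [Finset.mem_Icc] at h
    rw [abs_of_nonneg (by exact_mod_cast h.1), one_mul]
    exact_mod_cast h.2
  · rw [Finset.mem_singleton] at h
    simpa [h] using h0

lemma digitBound_gapDigits {p i : ℕ} {H : Set ℕ} {e : ℕ → ℤ}
    (he : ∀ j, e j ∈ gapDigits p H i j) : DigitBound 2 e := fun j => by
  have h := he j
  have h0 := zero_le_two_pow_sub_one j
  unfold gapDigits at h
  split_ifs at h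
  · rw [Finset.mem_Icc] at h
    rw [abs_le]
    exact ⟨by exact_mod_cast h.1, by exact_mod_cast h.2⟩
  · rw [Finset.mem_singleton] at h
    simpa [h] using h0

lemma DigitBound.mono {c d : ℝ} {e : ℕ → ℤ} (he : DigitBound c e) (hcd : c ≤ d) :
    DigitBound d e := fun j =>
  (he j).trans (mul_le_mul_of_nonneg_right hcd (zero_le_two_pow_sub_one j))

lemma zero_mem_stdDigits (H : Set ℕ) (j : ℕ) : (0 : ℤ) ∈ stdDigits H j := by
  unfold stdDigits
  split_ifs
  · rw [Finset.mem_Icc]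
    exact ⟨le_rfl, sub_nonneg.2 (one_le_pow₀ one_le_two)⟩
  · simp

lemma stdDigits_eq_of_notMem {H : Set ℕ} {j : ℕ} (hj : j ∉ H) : stdDigits H j = {0} := by
  simp [stdDigits, hj]

lemma gapDigits_eq_of_notMem {p i : ℕ} {H : Set ℕ} {j : ℕ} (hj : j ∉ H) :
    gapDigits p H i j = {0} := by
  simp [gapDigits, hj]

lemma card_stdDigits_le (H : Set ℕ) (j : ℕ) : (stdDigits H j).card ≤ 2 ^ j := by
  unfold stdDigits
  split_ifs
  · rw [Int.card_Icc]
    have : (2 : ℤ) ^ j - 1 + 1 - 0 = ((2 ^ j : ℕ) : ℤ) := by push_cast; ring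
    rw [this, Int.toNat_natCast]
  · simpa using Nat.one_le_two_pow

lemma card_gapDigits_le (p : ℕ) (H : Set ℕ) (i j : ℕ) :
    (gapDigits p H i j).card ≤ if j % p = i then 1 else 2 ^ (j + 2) := by
  unfold gapDigits
  split_ifs with h1 h2
  · exact absurd h2 h1.2
  · rw [Int.card_Icc, Int.toNat_le]
    push_cast
    have : (1 : ℤ) ≤ 2 ^ j := one_le_pow₀ one_le_two
    rw [pow_add]
    linarith
  · simp
  · simpa using Nat.one_le_two_pow

lemma prod_card_stdDigits_le (H : Set ℕ) (M : ℕ) :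
    ∏ j ∈ Finset.range M, (stdDigits H j).card ≤ 2 ^ tri M := by
  rw [tri, ← Finset.prod_pow_eq_pow_sum]
  exact Finset.prod_le_prod' fun j _ => card_stdDigits_le H j

/-- Induction in steps of `p`: a window of `p` consecutive indices starting at `m` contains a member
of the residue class, contributing at least `m`, while the whole window adds at most `p * (m + p)`
to `tri`. -/
lemma tri_le_mul_sum_residue {p i : ℕ} (hi : i < p) (M : ℕ) :
    tri M ≤ p * (∑ j ∈ Finset.range M, if j % p = i then j else 0) + p * M := by
  induction M using Nat.strong_induction_on with
  | _ M ih =>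
    rcases lt_or_ge M p with hM | hM
    · have : tri M ≤ M * M := by
        calc tri M ≤ ∑ _j ∈ Finset.range M, M :=
              Finset.sum_le_sum fun j hj => (Finset.mem_range.1 hj).le
          _ = M * M := by simp
      exact this.trans ((Nat.mul_le_mul_right M hM.le).trans (Nat.le_add_left _ _))
    · obtain ⟨m, rfl⟩ : ∃ m, M = m + p := ⟨M - p, by omega⟩
      have h := ih m (by omega)
      have h1 : tri (m + p) ≤ tri m + p * (m + p) := by
        rw [tri, Finset.sum_range_add, ← tri]
        refine Nat.add_le_add_left ?_ _
        calc ∑ x ∈ Finset.range p, (m + x) ≤ ∑ _x ∈ Finset.range p, (m + p) :=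
              Finset.sum_le_sum fun x hx => by have := Finset.mem_range.1 hx; omega
          _ = p * (m + p) := by simp
      have h2 : m ≤ ∑ x ∈ Finset.range p, if (m + x) % p = i then m + x else 0 := by
        have hmod : (m + (i + (p - m % p)) % p) % p = i := by
          rw [Nat.add_mod_mod]
          have h3 := Nat.mod_lt m (by omega : 0 < p)
          have h4 := Nat.div_add_mod m p
          have : m + (i + (p - m % p)) = i + p * (m / p + 1) := by
            rw [mul_add, mul_one]; omega
          rw [this, Nat.add_mul_mod_self_left, Nat.mod_eq_of_lt hi]
        have hmem : (i + (p - m % p)) % p ∈ Finset.range p :=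
          Finset.mem_range.2 (Nat.mod_lt _ (by omega))
        have := Finset.single_le_sum
          (f := fun x => if (m + x) % p = i then m + x else 0) (fun _ _ => Nat.zero_le _) hmem
        simp only [hmod, if_true] at this
        omega
      rw [Finset.sum_range_add]
      nlinarith

/-- A place outside the residue class costs `j + 2` bits, a place inside costs none. The class
carries a share `1 / p` of `tri M`, up to an error of `M`; the two extra bits per place account for
the remaining `2 * M`. -/
lemma prod_card_gapDigits_le {p i : ℕ} (hi : i < p) (H : Set ℕ) (M : ℕ) :
    ((∏ j ∈ Finset.range M, (gapDigits p H i j).card : ℕ) : ℝ) ≤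
      2 ^ ((1 - 1 / (p : ℝ)) * tri M + 3 * M) := by
  have hp : (0 : ℝ) < p := by exact_mod_cast (by omega : 0 < p)
  have h1 : ∏ j ∈ Finset.range M, (gapDigits p H i j).card ≤
      2 ^ ∑ j ∈ Finset.range M, if j % p = i then 0 else j + 2 := by
    rw [← Finset.prod_pow_eq_pow_sum]
    refine Finset.prod_le_prod' fun j _ => (card_gapDigits_le p H i j).trans (le_of_eq ?_)
    split_ifs <;> simp
  have h2 : (∑ j ∈ Finset.range M, if j % p = i then 0 else j + 2) +
      (∑ j ∈ Finset.range M, if j % p = i then j else 0) ≤ tri M + 2 * M := by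
    rw [← Finset.sum_add_distrib]
    calc _ ≤ ∑ j ∈ Finset.range M, (j + 2) :=
          Finset.sum_le_sum fun j _ => by split_ifs <;> omega
      _ = _ := by simp [Finset.sum_add_distrib, tri, mul_comm]
  have h3 := tri_le_mul_sum_residue hi M
  calc ((∏ j ∈ Finset.range M, (gapDigits p H i j).card : ℕ) : ℝ)
      ≤ ((2 ^ (∑ j ∈ Finset.range M, if j % p = i then 0 else j + 2) : ℕ) : ℝ) := by
        exact_mod_cast h1
    _ = (2 : ℝ) ^ ((∑ j ∈ Finset.range M, if j % p = i then 0 else j + 2 : ℕ) : ℝ) := by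
        rw [Real.rpow_natCast]; push_cast; rfl
    _ ≤ _ := by
        refine Real.rpow_le_rpow_of_exponent_le one_le_two ?_
        set x := ∑ j ∈ Finset.range M, if j % p = i then 0 else j + 2
        set y := ∑ j ∈ Finset.range M, if j % p = i then j else 0
        have h2' : (x : ℝ) + y ≤ tri M + 2 * M := by exact_mod_cast h2
        have h3' : (tri M : ℝ) ≤ p * y + p * M := by exact_mod_cast h3
        have h4 : (tri M : ℝ) / p ≤ y + M := by
          rw [div_le_iff₀ hp]; linarith
        have h5 : (1 - 1 / (p : ℝ)) * tri M = tri M - tri M / p := by ring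
        rw [h5]
        linarith

/-- The numbers all of whose digits in some residue class modulo `p` vanish. -/
def gapSet (p : ℕ) (b : ℝ) (H : Set ℕ) : Set ℝ :=
  ⋃ i ∈ Finset.range p, digitSet b (gapDigits p H i)

variable {b : ℝ}

lemma isCompact_gapSet (p : ℕ) (h0 : 0 < b) (h1 : b ≤ 1 / 2) (H : Set ℕ) :
    IsCompact (gapSet p b H) :=
  (Finset.range p).isCompact_biUnion fun _ _ =>
    isCompact_digitSet zero_le_two (fun _ he => digitBound_gapDigits he) h0 h1

lemma isCompact_digitSet_stdDigits (h0 : 0 < b) (h1 : b ≤ 1 / 2) (H : Set ℕ) :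
    IsCompact (digitSet b (stdDigits H)) :=
  isCompact_digitSet zero_le_one (fun _ he => digitBound_stdDigits he) h0 h1

lemma abs_le_of_mem_gapSet {p : ℕ} (h0 : 0 < b) (h1 : b ≤ 1 / 2) {H : Set ℕ} {x : ℝ}
    (hx : x ∈ gapSet p b H) : |x| ≤ 2 := by
  obtain ⟨i, -, e, he, rfl⟩ := mem_iUnion₂.1 hx
  exact (digitBound_gapDigits he).abs_digitSum_le zero_le_two h0 h1

lemma abs_le_of_mem_digitSet_stdDigits (h0 : 0 < b) (h1 : b ≤ 1 / 2) {H : Set ℕ} {x : ℝ}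
    (hx : x ∈ digitSet b (stdDigits H)) : |x| ≤ 1 := by
  obtain ⟨e, he, rfl⟩ := hx
  exact (digitBound_stdDigits he).abs_digitSum_le zero_le_one h0 h1

lemma digitSet_stdDigits_mono (b : ℝ) {H H' : Set ℕ} (h : H ⊆ H') :
    digitSet b (stdDigits H) ⊆ digitSet b (stdDigits H') := by
  refine image_mono fun e he j => ?_
  have := he j
  by_cases h1 : j ∈ H
  · unfold stdDigits at this ⊢
    rw [if_pos h1] at this
    rwa [if_pos (h h1)]
  · rw [stdDigits_eq_of_notMem h1, Finset.mem_singleton] at this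
    rw [this]
    exact zero_mem_stdDigits H' j

/-- The arithmetic heart of the construction: a common radius for all coordinates. -/
lemma exists_common_radius {n : ℕ} (h0 : 0 < b) (h1 : b ≤ 1 / 2) {H : Set ℕ} {x : Fin n → ℝ}
    (hx : ∀ i, x i ∈ digitSet b (stdDigits H)) :
    ∃ ρ : ℝ, |ρ| ≤ 1 ∧ ∀ i, x i + ρ ∈ gapSet (2 * n) b H ∧ x i - ρ ∈ gapSet (2 * n) b H := by
  rcases Nat.eq_zero_or_pos n with rfl | hn
  · exact ⟨0, by simp, fun i => i.elim0⟩
  choose e he hex using hx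
  have hlt : ∀ j, j % (2 * n) / 2 < n := fun j => by
    have := Nat.mod_lt j (by omega : 0 < 2 * n)
    omega
  -- The residue `j % (2 * n)` encodes a pair: its half selects the coordinate, its parity the sign.
  -- Even residues cancel digits of `x i + ρ`, odd ones digits of `x i - ρ`.
  set r : ℕ → ℤ := fun j => if j % (2 * n) % 2 = 0 then -e ⟨_, hlt j⟩ j else e ⟨_, hlt j⟩ j with hr
  have hrb : DigitBound 1 r := fun j => by
    have := digitBound_stdDigits (he ⟨_, hlt j⟩) j
    simp only [hr]
    split_ifs
    · rwa [Int.cast_neg, abs_neg]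
    · exact this
  have hr0 : ∀ j ∉ H, r j = 0 := fun j hj => by
    have : e ⟨_, hlt j⟩ j = 0 := by
      have := he ⟨_, hlt j⟩ j
      rwa [stdDigits_eq_of_notMem hj, Finset.mem_singleton] at this
    simp [hr, this]
  have hmem : ∀ (f : ℕ → ℤ) (i : ℕ), (∀ j ∉ H, f j = 0) → (∀ j, j % (2 * n) = i → f j = 0) →
      DigitBound 2 f → ∀ j, f j ∈ gapDigits (2 * n) H i j := by
    intro f i h2 h3 h4 j
    unfold gapDigits
    split_ifs with h5
    · have := abs_le.1 (h4 j)
      rw [Finset.mem_Icc]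
      exact ⟨by exact_mod_cast this.1, by exact_mod_cast this.2⟩
    · rw [Finset.mem_singleton]
      by_cases hj : j ∈ H
      · exact h3 j (by tauto)
      · exact h2 j hj
  have he0 : ∀ i, ∀ j ∉ H, e i j = 0 := fun i j hj => by
    have := he i j
    rwa [stdDigits_eq_of_notMem hj, Finset.mem_singleton] at this
  have heb : ∀ i, DigitBound 1 (e i) := fun i => digitBound_stdDigits (he i)
  refine ⟨digitSum b r, hrb.abs_digitSum_le zero_le_one h0 h1, fun i => ⟨?_, ?_⟩⟩
  · refine mem_iUnion₂.2 ⟨2 * i, Finset.mem_range.2 (by omega), fun j => e i j + r j,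
      hmem _ _ (fun j hj => by rw [he0 i j hj, hr0 j hj, add_zero]) (fun j hj => ?_)
        (fun j => ?_), ?_⟩
    · have hi : (⟨_, hlt j⟩ : Fin n) = i := Fin.ext (by simp only; omega)
      simp only [hr]
      rw [if_pos (by omega), hi]
      ring
    · have h2 := heb i j
      have h3 := hrb j
      push_cast
      exact (abs_add_le _ _).trans (by linarith)
    · rw [(heb i).digitSum_add zero_le_one zero_le_one hrb h0 h1, hex i]
  · refine mem_iUnion₂.2 ⟨2 * i + 1, Finset.mem_range.2 (by omega), fun j => e i j - r j,
      hmem _ _ (fun j hj => by rw [he0 i j hj, hr0 j hj, sub_zero]) (fun j hj => ?_)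
        (fun j => ?_), ?_⟩
    · have hi : (⟨_, hlt j⟩ : Fin n) = i := Fin.ext (by simp only; omega)
      simp only [hr]
      rw [if_neg (by omega), hi]
      ring
    · have h2 := heb i j
      have h3 := hrb j
      push_cast
      exact (abs_sub _ _).trans (by linarith)
    · rw [(heb i).digitSum_sub zero_le_one zero_le_one hrb h0 h1, hex i]

lemma covers_stdDigits (h0 : 0 < b) (h1 : b ≤ 1 / 2) (H : Set ℕ) (M : ℕ) :
    Covers (digitSet b (stdDigits H)) (2 * b ^ tri M) (2 ^ (tri M : ℝ)) := by
  refine (covers_digitSet (fun e he => (digitBound_stdDigits he).mono one_le_two) h0 h1 M).mono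
    subset_rfl le_rfl ?_
  rw [Real.rpow_natCast]
  exact_mod_cast prod_card_stdDigits_le H M

lemma covers_digitSet_of_finite {E : ℕ → Finset ℤ} {J : ℕ} (hE : ∀ j, J ≤ j → E j = {0})
    {ε : ℝ} (hε : 0 ≤ ε) :
    Covers (digitSet b E) ε ((∏ j ∈ Finset.range J, (E j).card : ℕ) : ℝ) := by
  obtain ⟨F, hF, hmem⟩ := exists_finset_partial_sums b E J
  refine ⟨F, by exact_mod_cast hF, ?_⟩
  rintro _ ⟨e, he, rfl⟩
  refine mem_iUnion₂.2 ⟨_, hmem e he, ?_⟩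
  rw [digitSum, tsum_eq_sum (s := Finset.range J)]
  · exact Metric.mem_closedBall_self hε
  · intro j hj
    have := he j
    rw [hE j (by simpa using hj), Finset.mem_singleton] at this
    simp [this]

lemma covers_stdDigits_of_finite (b : ℝ) (J : ℕ) {ε : ℝ} (hε : 0 ≤ ε) :
    Covers (digitSet b (stdDigits (Iio J))) ε (2 ^ (tri J : ℝ)) := by
  refine (covers_digitSet_of_finite (fun j hj => stdDigits_eq_of_notMem (by simpa using hj))
    hε).mono subset_rfl le_rfl ?_
  rw [Real.rpow_natCast]
  exact_mod_cast prod_card_stdDigits_le (Iio J) J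

lemma exists_sum_prod_card_gapDigits_le (p : ℕ) {u : ℝ} (hu : 1 - 1 / (p : ℝ) < u) :
    ∃ C : ℝ, 0 ≤ C ∧ ∀ (H : Set ℕ) (M : ℕ),
      ∑ i ∈ Finset.range p, ((∏ j ∈ Finset.range M, (gapDigits p H i j).card : ℕ) : ℝ) ≤
        C * 2 ^ (u * tri M) := by
  obtain ⟨C, hC0, hC⟩ := exists_le_mul_tri_add
    (show 0 < (u - (1 - 1 / (p : ℝ))) / 3 by linarith)
  refine ⟨p * 2 ^ (3 * C), by positivity, fun H M => ?_⟩
  calc _ ≤ ∑ _i ∈ Finset.range p, (2 : ℝ) ^ (3 * C + u * tri M) := by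
        refine Finset.sum_le_sum fun i hi =>
          (prod_card_gapDigits_le (Finset.mem_range.1 hi) H M).trans ?_
        refine Real.rpow_le_rpow_of_exponent_le one_le_two ?_
        have := hC M
        linarith
    _ = _ := by
        rw [Finset.sum_const, Finset.card_range, nsmul_eq_mul, Real.rpow_add two_pos, mul_assoc]

/-- Two regimes with one constant: truncating after `M` digits covers at scale `2 * b ^ tri M`,
whereas a set using only the first `J` digits is finite and its cardinality bounds the cover at
every scale. -/
lemma exists_covers_gapSet (p : ℕ) {u : ℝ} (hu : 1 - 1 / (p : ℝ) < u) :
    ∃ C : ℝ, 0 ≤ C ∧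
      (∀ b : ℝ, 0 < b → b ≤ 1 / 2 → ∀ (H : Set ℕ) (M : ℕ),
        Covers (gapSet p b H) (2 * b ^ tri M) (C * 2 ^ (u * tri M))) ∧
      ∀ (b : ℝ) (J : ℕ) (ε : ℝ), 0 ≤ ε →
        Covers (gapSet p b (Iio J)) ε (C * 2 ^ (u * tri J)) := by
  obtain ⟨C, hC0, hC⟩ := exists_sum_prod_card_gapDigits_le p hu
  refine ⟨C, hC0, fun b h0 h1 H M => ?_, fun b J ε hε => ?_⟩
  · refine (Covers.biUnion _ fun i _ => ?_).mono subset_rfl le_rfl (hC H M)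
    exact covers_digitSet (fun e he => digitBound_gapDigits he) h0 h1 M
  · refine (Covers.biUnion _ fun i _ => ?_).mono subset_rfl le_rfl (hC (Iio J) J)
    exact covers_digitSet_of_finite (fun j hj => gapDigits_eq_of_notMem (by simpa using hj)) hε

/-- Interpolates from the scales `2 * b ^ tri M` to all `ε`. Rounding to the next scale raises `tri
m` by `m`, which the slack `u' - u` absorbs. -/
lemma exists_covers_of_scales {θ u u' C : ℝ} (hθ : 0 < θ) (hu : 0 ≤ u) (huu' : u < u')
    (hC : 0 ≤ C) (hb : b = 2 ^ (-1 / θ)) (h1 : b ≤ 1 / 2) :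
    ∃ C' : ℝ, 0 ≤ C' ∧ ∀ A : Set ℝ, (∀ M, Covers A (2 * b ^ tri M) (C * 2 ^ (u * tri M))) →
      ∀ ε : ℝ, 0 < ε → ε ≤ 1 → Covers A ε (C' * ε ^ (-(u' * θ))) := by
  have h0 : 0 < b := by rw [hb]; positivity
  -- Dividing by `u + 1` instead of `u` keeps the case `u = 0` harmless.
  obtain ⟨C₁, hC₁0, hC₁⟩ := exists_le_mul_tri_add
    (show 0 < (u' - u) / (u + 1) by apply div_pos <;> linarith)
  refine ⟨C * 2 ^ (u * C₁) * 2 ^ (u' * θ), by positivity, fun A hA ε hε hε1 => ?_⟩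
  have hex : ∃ M, 2 * b ^ tri M ≤ ε := by
    have := ((tendsto_pow_tri h0 h1).const_mul 2).eventually_lt_const (u := ε) (by simpa using hε)
    obtain ⟨M, hM⟩ := this.exists
    exact ⟨M, hM.le⟩
  classical
  -- At index `0` the scale is `2`, which exceeds `ε ≤ 1`.
  obtain ⟨m, hm⟩ : ∃ m, Nat.find hex = m + 1 := by
    refine Nat.exists_eq_succ_of_ne_zero fun h => ?_
    have := Nat.find_spec hex
    rw [h] at this
    norm_num at this
    linarith
  have hle : 2 * b ^ tri (m + 1) ≤ ε := hm ▸ Nat.find_spec hex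
  have hgt : ε < 2 * b ^ tri m := not_le.1 (Nat.find_min hex (by omega))
  refine (hA (m + 1)).mono subset_rfl hle ?_
  have hbm : (b ^ tri m) ^ (-(u' * θ)) = 2 ^ (u' * tri m) := by
    rw [hb, ← Real.rpow_natCast, ← Real.rpow_mul two_pos.le, ← Real.rpow_mul two_pos.le]
    congr 1
    field_simp
  have hu'0 : 0 < u' * θ := mul_pos (hu.trans_lt huu') hθ
  have h3 : (2 : ℝ) ^ (u' * tri m) ≤ 2 ^ (u' * θ) * ε ^ (-(u' * θ)) := by
    rw [← hbm]
    calc (b ^ tri m) ^ (-(u' * θ)) ≤ (ε / 2) ^ (-(u' * θ)) :=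
          Real.rpow_le_rpow_of_nonpos (by positivity) (by linarith) (by linarith)
      _ = _ := by
          rw [Real.div_rpow hε.le two_pos.le, Real.rpow_neg two_pos.le]
          field_simp
  have h4 : u * tri (m + 1) ≤ u * C₁ + u' * tri m := by
    rw [tri_succ]
    push_cast
    have h5 : (m : ℝ) ≤ (u' - u) / (u + 1) * tri m + C₁ := hC₁ m
    have h6 : u * ((u' - u) / (u + 1)) ≤ u' - u := by
      rw [mul_div_assoc', div_le_iff₀ (by linarith)]
      nlinarith
    have h7 : (0 : ℝ) ≤ tri m := Nat.cast_nonneg _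
    nlinarith
  calc C * 2 ^ (u * tri (m + 1)) ≤ C * 2 ^ (u * C₁ + u' * tri m) :=
        mul_le_mul_of_nonneg_left (Real.rpow_le_rpow_of_exponent_le one_le_two h4) hC
    _ = C * 2 ^ (u * C₁) * 2 ^ (u' * tri m) := by rw [Real.rpow_add two_pos]; ring
    _ ≤ C * 2 ^ (u * C₁) * (2 ^ (u' * θ) * ε ^ (-(u' * θ))) :=
        mul_le_mul_of_nonneg_left h3 (by positivity)
    _ = _ := by ring

end DigitFamilies

/-! ### Products, plates and the sets containing skeletons -/

section Products

lemma Covers.image {X Y : Type*} [PseudoMetricSpace X] [PseudoMetricSpace Y] {A : Set X}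
    {ε N K : ℝ} (h : Covers A ε N) (hK : 0 ≤ K) (f : X → Y)
    (hf : ∀ x y, dist (f x) (f y) ≤ K * dist x y) : Covers (f '' A) (K * ε) N := by
  classical
  obtain ⟨F, hF, hcov⟩ := h
  refine ⟨F.image f, le_trans (by exact_mod_cast Finset.card_image_le) hF, ?_⟩
  rintro _ ⟨x, hx, rfl⟩
  obtain ⟨y, hy, hxy⟩ := mem_iUnion₂.1 (hcov hx)
  exact mem_iUnion₂.2 ⟨f y, Finset.mem_image_of_mem f hy,
    (hf x y).trans (mul_le_mul_of_nonneg_left hxy hK)⟩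

variable {n : ℕ}

lemma EuclideanSpace.dist_le_sqrt_mul {x y : EuclideanSpace ℝ (Fin n)} {ε : ℝ} (hε : 0 ≤ ε)
    (h : ∀ i, dist (x i) (y i) ≤ ε) : dist x y ≤ √n * ε := by
  rw [EuclideanSpace.dist_eq]
  refine Real.sqrt_le_iff.2 ⟨by positivity, ?_⟩
  rw [mul_pow, Real.sq_sqrt (Nat.cast_nonneg _)]
  calc ∑ i, dist (x i) (y i) ^ 2 ≤ ∑ _i : Fin n, ε ^ 2 :=
        Finset.sum_le_sum fun i _ => pow_le_pow_left₀ dist_nonneg (h i) 2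
    _ = n * ε ^ 2 := by simp

lemma EuclideanSpace.dist_coord_le (x y : EuclideanSpace ℝ (Fin n)) (i : Fin n) :
    dist (x i) (y i) ≤ dist x y := by
  rw [dist_eq_norm, dist_eq_norm, ← PiLp.sub_apply]
  exact PiLp.norm_apply_le (x - y) i

lemma Covers.pi {A : Fin n → Set ℝ} {ε : ℝ} {N : Fin n → ℝ} (hε : 0 ≤ ε)
    (h : ∀ i, Covers (A i) ε (N i)) :
    Covers {y : EuclideanSpace ℝ (Fin n) | ∀ i, y i ∈ A i} (√n * ε) (∏ i, N i) := by
  classical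
  choose F hF hcov using h
  refine ⟨(Fintype.piFinset F).image (WithLp.toLp 2), ?_, fun y hy => ?_⟩
  · calc ((((Fintype.piFinset F).image (WithLp.toLp 2)).card : ℕ) : ℝ)
        ≤ ((Fintype.piFinset F).card : ℝ) := by exact_mod_cast Finset.card_image_le
      _ = ∏ i, ((F i).card : ℝ) := by rw [Fintype.card_piFinset]; push_cast; rfl
      _ ≤ _ := Finset.prod_le_prod (fun _ _ => Nat.cast_nonneg _) fun i _ => hF i
  · have hex : ∀ i, ∃ c ∈ F i, dist (y i) c ≤ ε := fun i => by
      obtain ⟨c, hc, hyc⟩ := mem_iUnion₂.1 (hcov i (hy i))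
      exact ⟨c, hc, hyc⟩
    choose c hc hyc using hex
    exact mem_iUnion₂.2 ⟨WithLp.toLp 2 c,
      Finset.mem_image_of_mem _ (Fintype.mem_piFinset.2 hc),
      EuclideanSpace.dist_le_sqrt_mul hε hyc⟩

lemma isCompact_euclidean_pi {A : Fin n → Set ℝ} (h : ∀ i, IsCompact (A i)) :
    IsCompact {y : EuclideanSpace ℝ (Fin n) | ∀ i, y i ∈ A i} := by
  have h1 := (isCompact_univ_pi h).image (PiLp.continuous_toLp 2 fun _ : Fin n => ℝ)
  convert h1 using 1
  ext y
  constructor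
  · intro hy
    exact ⟨WithLp.ofLp y, fun i _ => hy i, rfl⟩
  · rintro ⟨z, hz, rfl⟩ i
    exact hz i (mem_univ i)

/-- The multiples of `ε` are the centres; there are `2 * ⌈4 / ε⌉ + 1 ≤ 8 / ε + 3 ≤ 11 / ε` of them.
-/
lemma covers_Icc {ε : ℝ} (h0 : 0 < ε) (h1 : ε ≤ 1) : Covers {y : ℝ | |y| ≤ 4} ε (11 * ε⁻¹) := by
  classical
  refine ⟨(Finset.Icc (-⌈4 / ε⌉) ⌈4 / ε⌉).image fun j : ℤ => (j : ℝ) * ε, ?_, fun y hy => ?_⟩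
  · refine le_trans (Nat.cast_le.2 Finset.card_image_le) ?_
    rw [Int.card_Icc]
    have hpos : (0 : ℤ) ≤ ⌈4 / ε⌉ := Int.ceil_nonneg (by positivity)
    have h2 : (((⌈4 / ε⌉ + 1 - -⌈4 / ε⌉).toNat : ℤ) : ℝ) = 2 * (⌈4 / ε⌉ : ℝ) + 1 := by
      rw [Int.toNat_of_nonneg (by linarith)]
      push_cast
      ring
    have h3 := Int.ceil_lt_add_one (4 / ε)
    have h4 : (1 : ℝ) ≤ ε⁻¹ := (one_le_inv₀ h0).2 h1
    rw [div_eq_mul_inv] at h3 h2 ⊢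
    calc _ = 2 * (⌈4 * ε⁻¹⌉ : ℝ) + 1 := by exact_mod_cast h2
      _ ≤ _ := by linarith
  · have hy' := abs_le.1 (show |y| ≤ 4 from hy)
    refine mem_iUnion₂.2 ⟨(⌊y / ε⌋ : ℝ) * ε, Finset.mem_image_of_mem _ ?_, ?_⟩
    · rw [Finset.mem_Icc]
      constructor
      · rw [Int.le_floor]
        push_cast
        have := Int.le_ceil (4 / ε)
        have h5 : -(4 / ε) ≤ y / ε := by
          rw [← neg_div]; exact div_le_div_of_nonneg_right hy'.1 h0.le
        linarith
      · exact (Int.floor_le_ceil _).trans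
          (Int.ceil_mono (div_le_div_of_nonneg_right hy'.2 h0.le))
    · rw [Metric.mem_closedBall, Real.dist_eq, abs_le]
      have h5 := Int.floor_le (y / ε)
      have h6 := (Int.lt_floor_add_one (y / ε)).le
      rw [le_div_iff₀ h0] at h5
      rw [div_le_iff₀ h0] at h6
      constructor <;> linarith

/-- The points with `k` coordinates in `[-4, 4]` and the others in `A`. -/
def plates (n k : ℕ) (A : Set ℝ) : Set (EuclideanSpace ℝ (Fin n)) :=
  {y | ∃ I : Finset (Fin n), I.card = k ∧ ∀ i, (i ∈ I → |y i| ≤ 4) ∧ (i ∉ I → y i ∈ A)}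

lemma plates_eq_biUnion (n k : ℕ) (A : Set ℝ) :
    plates n k A = ⋃ I ∈ Finset.powersetCard k (Finset.univ : Finset (Fin n)),
      {y | ∀ i, y i ∈ if i ∈ I then {y : ℝ | |y| ≤ 4} else A} := by
  ext y
  simp only [plates, mem_ofPred_eq, mem_iUnion, Finset.mem_powersetCard, Finset.subset_univ,
    true_and, exists_prop]
  refine exists_congr fun I => and_congr_right fun _ => forall_congr' fun i => ?_
  by_cases hi : i ∈ I <;> simp [hi]

lemma isCompact_plates (n k : ℕ) {A : Set ℝ} (hA : IsCompact A) : IsCompact (plates n k A) := by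
  rw [plates_eq_biUnion]
  refine Finset.isCompact_biUnion _ fun I _ => isCompact_euclidean_pi fun i => ?_
  split_ifs
  · have : {y : ℝ | |y| ≤ 4} = Icc (-4) 4 := by ext y; simp [abs_le]
    rw [this]
    exact isCompact_Icc
  · exact hA

lemma Covers.plates {k : ℕ} {A : Set ℝ} {ε N : ℝ} (h0 : 0 < ε) (h1 : ε ≤ 1)
    (h : Covers A ε N) :
    Covers (plates n k A) (√n * ε) (n.choose k * ((11 * ε⁻¹) ^ k * N ^ (n - k))) := by
  classical
  rw [plates_eq_biUnion]
  have hsum : ∑ _I ∈ Finset.powersetCard k (Finset.univ : Finset (Fin n)),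
      ((11 * ε⁻¹) ^ k * N ^ (n - k)) = n.choose k * ((11 * ε⁻¹) ^ k * N ^ (n - k)) := by
    rw [Finset.sum_const, Finset.card_powersetCard, Finset.card_univ, Fintype.card_fin,
      nsmul_eq_mul]
  rw [← hsum]
  refine Covers.biUnion _ fun I hI => ?_
  have hcard := (Finset.mem_powersetCard.1 hI).2
  have hprod : ∏ i, (if i ∈ I then 11 * ε⁻¹ else N) = (11 * ε⁻¹) ^ k * N ^ (n - k) := by
    rw [Finset.prod_ite]
    simp only [Finset.prod_const]
    have e1 : Finset.filter (fun i => i ∈ I) Finset.univ = I := by simp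
    have e2 : Finset.filter (fun i => i ∉ I) Finset.univ = Iᶜ := by ext; simp
    rw [e1, e2, Finset.card_compl, Fintype.card_fin, hcard]
  rw [← hprod]
  refine Covers.pi h0.le fun i => ?_
  split_ifs
  · exact covers_Icc h0 h1
  · exact h

/-- The product of `n` copies of the set of numbers with standard digits. -/
def stdProd (n : ℕ) (b : ℝ) (H : Set ℕ) : Set (EuclideanSpace ℝ (Fin n)) :=
  {x | ∀ i, x i ∈ digitSet b (stdDigits H)}

/-- The two translates of `gapSet` by `±2`. -/
def shiftedGapSet (p : ℕ) (b : ℝ) (H : Set ℕ) : Set ℝ :=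
  (fun x => x + 2) '' gapSet p b H ∪ (fun x => x - 2) '' gapSet p b H

/-- A set containing the `k`-skeleton of a cube around every point of `stdProd n b H`. -/
def skelSet (n k : ℕ) (b : ℝ) (H : Set ℕ) : Set (EuclideanSpace ℝ (Fin n)) :=
  plates n k (shiftedGapSet (2 * n) b H)

variable {b : ℝ} {k : ℕ}

lemma isCompact_stdProd (n : ℕ) (h0 : 0 < b) (h1 : b ≤ 1 / 2) (H : Set ℕ) :
    IsCompact (stdProd n b H) :=
  isCompact_euclidean_pi fun _ => isCompact_digitSet_stdDigits h0 h1 H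

lemma isCompact_skelSet (n k : ℕ) (h0 : 0 < b) (h1 : b ≤ 1 / 2) (H : Set ℕ) :
    IsCompact (skelSet n k b H) :=
  isCompact_plates n k
    (((isCompact_gapSet (2 * n) h0 h1 H).image (by fun_prop)).union
      ((isCompact_gapSet (2 * n) h0 h1 H).image (by fun_prop)))

lemma zero_mem_stdProd (n : ℕ) (b : ℝ) (H : Set ℕ) :
    (0 : EuclideanSpace ℝ (Fin n)) ∈ stdProd n b H :=
  fun _ => ⟨fun _ => 0, zero_mem_stdDigits H, by simp [digitSum]⟩

lemma exists_cubeSkeleton_subset (h0 : 0 < b) (h1 : b ≤ 1 / 2) {H : Set ℕ}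
    {x : EuclideanSpace ℝ (Fin n)} (hx : x ∈ stdProd n b H) :
    ∃ r : ℝ, 0 < r ∧ cubeSkeleton k x r ⊆ skelSet n k b H := by
  obtain ⟨ρ, hρ, hgap⟩ := exists_common_radius h0 h1 hx
  have hρ' := abs_le.1 hρ
  -- As `|ρ| ≤ 1`, the shift by `2` makes the radius positive and at most `3`. With `|x i| ≤ 1` the
  -- free coordinates then stay within `4`.
  refine ⟨2 + ρ, by linarith, ?_⟩
  rintro y ⟨I, hI, hy⟩
  refine ⟨I, hI, fun i => ⟨fun hi => ?_, fun hi => ?_⟩⟩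
  · have h2 := (hy i).1 hi
    have h3 := abs_le.1 (abs_le_of_mem_digitSet_stdDigits h0 h1 (hx i))
    rw [abs_le]
    exact ⟨by linarith [h2.1], by linarith [h2.2]⟩
  · rcases (hy i).2 hi with h2 | h2
    · exact Or.inr ⟨_, (hgap i).2, by rw [h2]; ring⟩
    · rw [mem_singleton_iff] at h2
      exact Or.inl ⟨_, (hgap i).1, by rw [h2]; ring⟩

lemma containsSkeletonAroundEach_skelSet (h0 : 0 < b) (h1 : b ≤ 1 / 2) (H : Set ℕ) :
    ContainsSkeletonAroundEach k (skelSet n k b H) (stdProd n b H) :=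
  fun _ hx => exists_cubeSkeleton_subset h0 h1 hx

lemma Covers.shiftedGapSet {p : ℕ} {H : Set ℕ} {ε N : ℝ} (h : Covers (gapSet p b H) ε N) :
    Covers (shiftedGapSet p b H) ε (2 * N) := by
  rw [two_mul]
  have h1 := h.image zero_le_one (fun x => x + 2) (by simp)
  have h2 := h.image zero_le_one (fun x => x - 2) (by simp)
  rw [one_mul] at h1 h2
  exact h1.union h2

lemma Covers.skelSet (hn : 0 < n) {H : Set ℕ} {ε N : ℝ} (hε : 0 < ε) (hε1 : ε ≤ 1)
    (h : Covers (gapSet (2 * n) b H) (ε / √n) N) :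
    Covers (skelSet n k b H) ε
      (n.choose k * ((11 * √n) ^ k * 2 ^ (n - k)) * (N ^ (n - k) * ε ^ (-(k : ℝ)))) := by
  have hs : (1 : ℝ) ≤ √n := by
    rw [Real.one_le_sqrt]; exact_mod_cast hn
  have hdiv : ε / √n ≤ 1 := (div_le_one (by linarith)).2 (hε1.trans hs)
  refine (Covers.plates (k := k) (n := n) (by positivity) hdiv h.shiftedGapSet).mono
    subset_rfl (le_of_eq ?_) (le_of_eq ?_)
  · field_simp
  · rw [Real.rpow_neg hε.le, Real.rpow_natCast, inv_div, mul_pow 2 N, ← inv_pow, mul_pow, mul_pow,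
      div_pow, inv_pow]
    field_simp

lemma Covers.stdProd (hn : 0 < n) {H : Set ℕ} {ε N : ℝ} (hε : 0 < ε)
    (h : Covers (digitSet b (stdDigits H)) (ε / √n) N) : Covers (stdProd n b H) ε (N ^ n) := by
  have hs : (0 : ℝ) < √n := Real.sqrt_pos.2 (by exact_mod_cast hn)
  refine (Covers.pi (by positivity) fun _ : Fin n => h).mono subset_rfl (le_of_eq ?_)
    (le_of_eq (by simp))
  field_simp

lemma exists_covers_stdProd (hn : 0 < n) {θ v : ℝ} (hθ : 0 < θ) (hb : b = 2 ^ (-1 / θ))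
    (h1 : b ≤ 1 / 2) (hv : 1 < v) :
    ∃ C : ℝ, (∀ H ε, 0 < ε → ε ≤ 1 → Covers (stdProd n b H) ε (C * ε ^ (-(n * θ * v)))) ∧
      ∀ J ε, 0 < ε → ε ≤ 1 → Covers (stdProd n b (Iio J)) ε (C * 2 ^ (n * v * tri J)) := by
  have h0 : 0 < b := by rw [hb]; positivity
  have hs : (1 : ℝ) ≤ √n := by
    rw [Real.one_le_sqrt]; exact_mod_cast hn
  obtain ⟨C, hC0, hC⟩ := exists_covers_of_scales hθ zero_le_one hv zero_le_one hb h1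
  refine ⟨max 1 ((C * √n ^ (v * θ)) ^ n), fun H ε hε hε1 => ?_, fun J ε hε hε1 => ?_⟩
  · have hdiv : ε / √n ≤ 1 := (div_le_one (by linarith)).2 (hε1.trans hs)
    have hc := hC (digitSet b (stdDigits H)) (fun M => by
      simpa using covers_stdDigits h0 h1 H M) (ε / √n) (by positivity) hdiv
    refine (Covers.stdProd hn hε hc).mono subset_rfl le_rfl ?_
    calc (C * (ε / √n) ^ (-(v * θ))) ^ n
        = (C * √n ^ (v * θ)) ^ n * ε ^ (-(n * θ * v)) := by
          rw [Real.div_rpow hε.le (by positivity), Real.rpow_neg (by positivity) (v * θ),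
            Real.rpow_neg (by positivity) (v * θ), Real.rpow_neg hε.le,
            show (n : ℝ) * θ * v = (v * θ) * n by ring, Real.rpow_mul hε.le (v * θ), Real.rpow_natCast (ε ^ (v * θ)),
            mul_pow, mul_pow, div_pow, inv_pow, inv_pow]
          field_simp
      _ ≤ _ := mul_le_mul_of_nonneg_right (le_max_right _ _) (by positivity)
  · refine (Covers.stdProd hn hε (covers_stdDigits_of_finite b J (by positivity))).mono
      subset_rfl le_rfl ?_
    calc ((2 : ℝ) ^ (tri J : ℝ)) ^ n = 2 ^ (n * (tri J : ℝ)) := by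
          rw [← Real.rpow_natCast, ← Real.rpow_mul two_pos.le, mul_comm]
      _ ≤ 2 ^ (n * v * tri J) := by
          refine Real.rpow_le_rpow_of_exponent_le one_le_two ?_
          rw [mul_assoc]
          refine mul_le_mul_of_nonneg_left ?_ (Nat.cast_nonneg _)
          have : (0 : ℝ) ≤ tri J := Nat.cast_nonneg _
          nlinarith
      _ ≤ _ := le_mul_of_one_le_left (by positivity) (le_max_left _ _)

/-- The constant is uniform in `H` and in `J`, which the multiscale union needs. In the second bound
the `n - k` gapped coordinates are finite sets, so only the `k` free ones contribute a power of `ε`.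
-/
lemma exists_covers_skelSet (hk : k < n) {θ v : ℝ} (hθ : 0 < θ) (hb : b = 2 ^ (-1 / θ))
    (h1 : b ≤ 1 / 2) (hv : 1 - 1 / (2 * n : ℝ) < v) :
    ∃ C : ℝ, (∀ H ε, 0 < ε → ε ≤ 1 →
        Covers (skelSet n k b H) ε (C * ε ^ (-(k + (n - k) * θ * v)))) ∧
      ∀ J ε, 0 < ε → ε ≤ 1 →
        Covers (skelSet n k b (Iio J)) ε (C * 2 ^ ((n - k) * v * tri J) * ε ^ (-(k : ℝ))) := by
  have hn : 0 < n := by omega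
  have h0 : 0 < b := by rw [hb]; positivity
  have hs : (1 : ℝ) ≤ √n := by
    rw [Real.one_le_sqrt]; exact_mod_cast hn
  have hn1 : (1 : ℝ) ≤ n := by exact_mod_cast hn
  obtain ⟨u, hu1, huv⟩ := exists_between hv
  have hu0 : 0 ≤ u := by
    refine le_trans ?_ hu1.le
    rw [sub_nonneg, div_le_one (by linarith)]
    linarith
  obtain ⟨C₀, hC₀, hcov, hfin⟩ := exists_covers_gapSet (2 * n) (u := u) (by push_cast; exact hu1)
  obtain ⟨C, hC0, hC⟩ := exists_covers_of_scales hθ hu0 huv hC₀ hb h1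
  have hnk : ((n - k : ℕ) : ℝ) = (n : ℝ) - k := Nat.cast_sub hk.le
  set D : ℝ := n.choose k * ((11 * √n) ^ k * 2 ^ (n - k)) with hD
  have hD0 : 0 ≤ D := by positivity
  refine ⟨max (D * C₀ ^ (n - k)) (D * (C * √n ^ (v * θ)) ^ (n - k)), fun H ε hε hε1 => ?_,
    fun J ε hε hε1 => ?_⟩
  · have hdiv : ε / √n ≤ 1 := (div_le_one (by linarith)).2 (hε1.trans hs)
    have hc := hC (gapSet (2 * n) b H) (fun M => hcov b h0 h1 H M) (ε / √n) (by positivity) hdiv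
    refine (Covers.skelSet (k := k) hn hε hε1 hc).mono subset_rfl le_rfl ?_
    calc D * ((C * (ε / √n) ^ (-(v * θ))) ^ (n - k) * ε ^ (-(k : ℝ)))
        = D * (C * √n ^ (v * θ)) ^ (n - k) * ε ^ (-(k + (n - k) * θ * v)) := by
          rw [Real.div_rpow hε.le (by positivity), Real.rpow_neg (by positivity) (v * θ),
            Real.rpow_neg (by positivity) (v * θ),
            show -((k : ℝ) + (n - k) * θ * v) = -(k : ℝ) + -((v * θ) * ((n - k : ℕ) : ℝ)) by
              rw [hnk]; ring,
            Real.rpow_add hε, Real.rpow_neg hε.le (v * θ * ((n - k : ℕ) : ℝ)),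
            Real.rpow_mul hε.le (v * θ), Real.rpow_natCast (ε ^ (v * θ)),
            mul_pow, mul_pow, div_pow, inv_pow, inv_pow]
          field_simp
      _ ≤ _ := mul_le_mul_of_nonneg_right (le_max_right _ _) (by positivity)
  · refine (Covers.skelSet (k := k) hn hε hε1 (hfin b J (ε / √n) (by positivity))).mono
      subset_rfl le_rfl ?_
    have hpow : ((2 : ℝ) ^ (u * tri J)) ^ (n - k) ≤ 2 ^ ((n - k) * v * tri J) := by
      rw [← Real.rpow_natCast, ← Real.rpow_mul two_pos.le, hnk]
      refine Real.rpow_le_rpow_of_exponent_le one_le_two ?_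
      have h5 : (0 : ℝ) ≤ (n - k) * tri J := by
        rw [← hnk]; positivity
      nlinarith
    calc D * ((C₀ * 2 ^ (u * tri J)) ^ (n - k) * ε ^ (-(k : ℝ)))
        = D * C₀ ^ (n - k) * (2 ^ (u * tri J)) ^ (n - k) * ε ^ (-(k : ℝ)) := by
          rw [mul_pow]; ring
      _ ≤ _ := by
          gcongr
          exact le_max_left _ _

lemma coverBound_stdProd (hn : 0 < n) {θ : ℝ} (hθ : 0 < θ) (hb : b = 2 ^ (-1 / θ))
    (h1 : b ≤ 1 / 2) (H : Set ℕ) : CoverBound (stdProd n b H) (n * θ) := fun t ht => by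
  have hnθ : 0 < n * θ := by positivity
  obtain ⟨C, hC, -⟩ := exists_covers_stdProd hn hθ hb h1 ((one_lt_div hnθ).2 ht)
  refine ⟨C, fun ε h0 h1 => ?_⟩
  have := hC H ε h0 h1
  rwa [mul_div_cancel₀ _ hnθ.ne'] at this

lemma coverBound_skelSet (hk : k < n) {θ : ℝ} (hθ : 0 < θ) (hb : b = 2 ^ (-1 / θ))
    (h1 : b ≤ 1 / 2) (H : Set ℕ) :
    CoverBound (skelSet n k b H) (k + (n - k) * θ * (1 - 1 / (2 * n : ℝ))) := fun t ht => by
  have hnk : (0 : ℝ) < n - k := sub_pos.2 (by exact_mod_cast hk)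
  have hnθ : 0 < (n - k) * θ := by positivity
  obtain ⟨C, hC, -⟩ := exists_covers_skelSet (v := (t - k) / ((n - k) * θ)) hk hθ hb h1
    (by rw [lt_div_iff₀ hnθ]; linarith)
  refine ⟨C, fun ε h0 h1 => ?_⟩
  have := hC H ε h0 h1
  rwa [mul_div_cancel₀ _ hnθ.ne', add_sub_cancel] at this

end Products

/-! ### Hausdorff dimension of the full digit sets -/

section HausdorffDimension

variable {b : ℝ}

lemma digitSum_eq_sum_of_finite {J : ℕ} {e : ℕ → ℤ} (he : ∀ j, J ≤ j → e j = 0) :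
    digitSum b e = ∑ j ∈ Finset.range J, (e j : ℝ) * b ^ tri (j + 1) :=
  tsum_eq_sum fun j hj => by simp [he j (by simpa using hj)]

/-- For base `1 / 2` the blocks regroup the binary expansion: the last block is `m % 2 ^ J`, and the
quotient is handled by induction. -/
lemma dyadic_mem_digitSet (J m : ℕ) (hm : m < 2 ^ tri J) :
    (m : ℝ) / 2 ^ tri J ∈ digitSet (1 / 2) (stdDigits (Iio J)) := by
  suffices h : ∃ e : ℕ → ℤ, (∀ j, e j ∈ stdDigits (Iio J) j) ∧
      ∑ j ∈ Finset.range J, (e j : ℝ) * (1 / 2) ^ tri (j + 1) = (m : ℝ) / 2 ^ tri J by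
    obtain ⟨e, he, hs⟩ := h
    refine ⟨e, he, ?_⟩
    rw [← hs]
    refine digitSum_eq_sum_of_finite fun j hj => ?_
    have := he j
    rwa [stdDigits_eq_of_notMem (by simpa using hj), Finset.mem_singleton] at this
  induction J generalizing m with
  | zero =>
    have : m = 0 := by simpa using hm
    exact ⟨fun _ => 0, zero_mem_stdDigits _, by simp [this]⟩
  | succ J ih =>
    have hq : m / 2 ^ J < 2 ^ tri J := by
      rw [Nat.div_lt_iff_lt_mul (by positivity), ← pow_add, ← tri_succ]
      exact hm
    obtain ⟨e, he, hs⟩ := ih _ hq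
    refine ⟨fun j => if j = J then ((m % 2 ^ J : ℕ) : ℤ) else e j, fun j => ?_, ?_⟩
    · by_cases hj : j = J
      · subst hj
        simp only [if_true, stdDigits]
        rw [if_pos (by simp), Finset.mem_Icc]
        have h1 : m % 2 ^ j < 2 ^ j := Nat.mod_lt _ (by positivity)
        have h2 : ((m % 2 ^ j : ℕ) : ℤ) < ((2 ^ j : ℕ) : ℤ) := by exact_mod_cast h1
        push_cast at h2
        exact ⟨by positivity, by push_cast; linarith⟩
      · simp only [if_neg hj]
        have := he j
        unfold stdDigits at this ⊢
        split_ifs at this with h1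
        · rwa [if_pos (by simp only [mem_Iio] at h1 ⊢; omega)]
        · rwa [if_neg (by simp only [mem_Iio] at h1 ⊢; omega)]
    · rw [Finset.sum_range_succ]
      have hsum : ∑ x ∈ Finset.range J,
          ((if x = J then ((m % 2 ^ J : ℕ) : ℤ) else e x : ℤ) : ℝ) * (1 / 2) ^ tri (x + 1) =
          ((m / 2 ^ J : ℕ) : ℝ) / 2 ^ tri J := by
        rw [← hs]
        refine Finset.sum_congr rfl fun x hx => ?_
        rw [if_neg (Finset.mem_range.1 hx).ne]
      rw [hsum, tri_succ]
      simp only [if_true]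
      have hmod : (m : ℝ) = 2 ^ J * ((m / 2 ^ J : ℕ) : ℝ) + ((m % 2 ^ J : ℕ) : ℝ) := by
        exact_mod_cast (Nat.div_add_mod m (2 ^ J)).symm
      rw [hmod, Int.cast_natCast, one_div, inv_pow, pow_add]
      field_simp

lemma Ico_subset_digitSet : Ico (0 : ℝ) 1 ⊆ digitSet (1 / 2) (stdDigits univ) := by
  intro u hu
  have hcl := (isCompact_digitSet_stdDigits (b := 1 / 2) (by norm_num) le_rfl univ).isClosed
  have hlim : Tendsto (fun J => (⌊u * 2 ^ tri J⌋₊ : ℝ) / 2 ^ tri J) atTop (𝓝 u) :=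
    (tendsto_nat_floor_mul_div_atTop hu.1).comp
      ((tendsto_pow_atTop_atTop_of_one_lt (one_lt_two (α := ℝ))).comp tendsto_tri)
  refine hcl.mem_of_tendsto hlim (Eventually.of_forall fun J => ?_)
  refine digitSet_stdDigits_mono _ (subset_univ (Iio J)) (dyadic_mem_digitSet J _ ?_)
  rw [Nat.floor_lt (by have := hu.1; positivity)]
  push_cast
  nlinarith [hu.2, (by positivity : (0 : ℝ) < 2 ^ tri J)]

lemma digitSum_sub_first_difference {e f : ℕ → ℤ} (he : ∀ j, e j ∈ stdDigits univ j)
    (hf : ∀ j, f j ∈ stdDigits univ j) {J : ℕ} (hJ : ∀ j < J, e j = f j)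
    (h0 : 0 < b) (h1 : b ≤ 1 / 2) :
    |digitSum b e - digitSum b f - (e J - f J) * b ^ tri (J + 1)| ≤ 2 * b * b ^ tri (J + 1) := by
  have hg : DigitBound 1 fun j => e j - f j := fun j => by
    have h2 := he j
    have h3 := hf j
    simp only [stdDigits, mem_univ, if_true, Finset.mem_Icc] at h2 h3
    rw [one_mul, abs_le]
    constructor
    · exact_mod_cast (by linarith : -((2 : ℤ) ^ j - 1) ≤ e j - f j)
    · exact_mod_cast (by linarith : e j - f j ≤ (2 : ℤ) ^ j - 1)
  rw [← (digitBound_stdDigits he).digitSum_sub zero_le_one zero_le_one (digitBound_stdDigits hf)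
    h0 h1, hg.digitSum_eq zero_le_one h0 h1 (J + 1), Finset.sum_range_succ,
    Finset.sum_eq_zero fun j hj => by
      rw [hJ j (Finset.mem_range.1 hj)]; simp]
  have := hg.abs_tail_le zero_le_one h0 h1 (J + 1)
  rw [one_mul] at this
  convert this using 2
  push_cast
  ring

/-- Let `J` be the first place where the digits differ. In base `1 / 2` the values differ by at most
`2 ^ (-tri J)`, in base `b` by at least `(1 - 2 * b) * b ^ tri (J + 1)`. Since `b ^ (tri (J + 1) *
η) = 2 ^ (-(η / θ) * tri (J + 1))` and `η < θ`, the loss `J` between the exponents is absorbed. -/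
lemma exists_holder_bound {θ η : ℝ} (hη : 0 < η) (hηθ : η < θ) (hb : b = 2 ^ (-1 / θ))
    (h1 : b ≤ 1 / 2) :
    ∃ C : ℝ, 0 ≤ C ∧ ∀ e f : ℕ → ℤ, (∀ j, e j ∈ stdDigits univ j) →
      (∀ j, f j ∈ stdDigits univ j) →
      |digitSum (1 / 2) e - digitSum (1 / 2) f| ≤ C * |digitSum b e - digitSum b f| ^ η := by
  have hθ : 0 < θ := hη.trans hηθ
  have h0 : 0 < b := by rw [hb]; positivity
  -- At `b = 1 / 2` the factor `1 - 2 * b` vanishes, as expansions are not unique; but then both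
  -- sides use the same base and `η < 1` suffices.
  rcases eq_or_lt_of_le h1 with hb2 | hb2
  · have hη1 : η < 1 := by
      refine hηθ.trans_le (le_of_not_gt fun h => ?_)
      have : (2 : ℝ) ^ (-1 : ℝ) < 2 ^ (-1 / θ) := by
        refine Real.rpow_lt_rpow_of_exponent_lt one_lt_two ?_
        rw [lt_div_iff₀ hθ]; linarith
      rw [← hb, hb2, Real.rpow_neg_one] at this
      norm_num at this
    refine ⟨2, zero_le_two, fun e f he hf => ?_⟩
    rw [hb2]
    set x := |digitSum (1 / 2) e - digitSum (1 / 2) f| with hx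
    have hx0 : 0 ≤ x := abs_nonneg _
    have hx2 : x ≤ 2 := by
      have h3 := (digitBound_stdDigits he).abs_digitSum_le zero_le_one (b := 1 / 2)
        (by norm_num) le_rfl
      have h4 := (digitBound_stdDigits hf).abs_digitSum_le zero_le_one (b := 1 / 2)
        (by norm_num) le_rfl
      exact (abs_sub _ _).trans (by linarith)
    rcases hx0.eq_or_lt with h | h
    · rw [← h]; positivity
    · calc x = x ^ (1 - η) * x ^ η := by
            rw [← Real.rpow_add h, sub_add_cancel, Real.rpow_one]
        _ ≤ 2 * x ^ η := by
            refine mul_le_mul_of_nonneg_right ?_ (by positivity)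
            calc x ^ (1 - η) ≤ 2 ^ (1 - η) := Real.rpow_le_rpow hx0 hx2 (by linarith)
              _ ≤ 2 ^ (1 : ℝ) := Real.rpow_le_rpow_of_exponent_le one_le_two (by linarith)
              _ = 2 := Real.rpow_one 2
  · obtain ⟨K, hK0, hK⟩ := exists_le_mul_tri_add
      (show 0 < 1 - η / θ by rw [sub_pos, div_lt_one hθ]; exact hηθ)
    have hgap : 0 < 1 - 2 * b := by linarith
    refine ⟨2 * 2 ^ K * ((1 - 2 * b) ^ η)⁻¹, by positivity, fun e f he hf => ?_⟩
    by_cases hef : e = f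
    · subst hef; simp [Real.zero_rpow hη.ne']
    have hex : ∃ j, e j ≠ f j := Function.ne_iff.1 hef
    classical
    set J := Nat.find hex with hJdef
    have hJne : e J ≠ f J := Nat.find_spec hex
    have hJ : ∀ j < J, e j = f j := fun j hj => not_not.1 (Nat.find_min hex hj)
    have hg1 : (1 : ℝ) ≤ |(e J : ℝ) - f J| := by
      have : (1 : ℤ) ≤ |e J - f J| := Int.one_le_abs (sub_ne_zero.2 hJne)
      exact_mod_cast this
    have hg2 : |(e J : ℝ) - f J| + 1 ≤ 2 ^ J := by
      have h2 := he J
      have h3 := hf J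
      simp only [stdDigits, mem_univ, if_true, Finset.mem_Icc] at h2 h3
      have : |e J - f J| + 1 ≤ 2 ^ J := by
        rw [← le_sub_iff_add_le, abs_le]
        constructor <;> linarith
      exact_mod_cast this
    have hup := digitSum_sub_first_difference he hf hJ (b := 1 / 2) (by norm_num) le_rfl
    have hlo := digitSum_sub_first_difference he hf hJ h0 h1
    have hT : 0 < b ^ tri (J + 1) := by positivity
    have hT2 : (0 : ℝ) < (1 / 2) ^ tri (J + 1) := by positivity
    have hlo' : (1 - 2 * b) * b ^ tri (J + 1) ≤ |digitSum b e - digitSum b f| := by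
      have h2 := abs_sub_abs_le_abs_sub ((e J - f J : ℝ) * b ^ tri (J + 1))
        (digitSum b e - digitSum b f)
      rw [abs_mul, abs_of_pos hT] at h2
      rw [abs_sub_comm] at hlo
      nlinarith
    have hup' : |digitSum (1 / 2) e - digitSum (1 / 2) f| ≤ 2 ^ J * (1 / 2) ^ tri (J + 1) := by
      have h2 := abs_sub_abs_le_abs_sub (digitSum (1 / 2) e - digitSum (1 / 2) f)
        ((e J - f J : ℝ) * (1 / 2) ^ tri (J + 1))
      rw [abs_mul, abs_of_pos hT2] at h2
      nlinarith
    have hbT : (b ^ tri (J + 1)) ^ η = 2 ^ (-(η / θ) * tri (J + 1)) := by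
      rw [hb, ← Real.rpow_natCast, ← Real.rpow_mul two_pos.le, ← Real.rpow_mul two_pos.le]
      congr 1
      field_simp
    have hhalf : (1 / 2 : ℝ) ^ tri (J + 1) = 2 ^ (-(tri (J + 1) : ℝ)) := by
      rw [Real.rpow_neg two_pos.le, Real.rpow_natCast, one_div, inv_pow]
    have hKJ := hK (J + 1)
    push_cast at hKJ
    calc |digitSum (1 / 2) e - digitSum (1 / 2) f| ≤ 2 ^ J * (1 / 2) ^ tri (J + 1) := hup'
      _ = 2 ^ ((J : ℝ) - tri (J + 1)) := by
          rw [hhalf, ← Real.rpow_natCast, ← Real.rpow_add two_pos, sub_eq_add_neg]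
      _ ≤ 2 ^ (1 + K + -(η / θ) * tri (J + 1)) := by
          refine Real.rpow_le_rpow_of_exponent_le one_le_two ?_
          linarith
      _ = 2 * 2 ^ K * ((1 - 2 * b) ^ η)⁻¹ * ((1 - 2 * b) * b ^ tri (J + 1)) ^ η := by
          rw [Real.mul_rpow hgap.le hT.le, hbT, Real.rpow_add two_pos, Real.rpow_add two_pos,
            Real.rpow_one]
          field_simp
      _ ≤ _ := mul_le_mul_of_nonneg_left (Real.rpow_le_rpow (by positivity) hlo' hη.le)
          (by positivity)

variable {n : ℕ}

lemma dimH_unitCube (n : ℕ) :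
    dimH {u : EuclideanSpace ℝ (Fin n) | ∀ i, u i ∈ Ico (0 : ℝ) 1} = n := by
  rw [Real.dimH_of_nonempty_interior, finrank_euclideanSpace_fin]
  have hopen : IsOpen {u : EuclideanSpace ℝ (Fin n) | ∀ i, u i ∈ Ioo (0 : ℝ) 1} := by
    simp only [ofPred_forall]
    exact isOpen_iInter_of_finite fun i => isOpen_Ioo.preimage (by fun_prop)
  refine ⟨WithLp.toLp 2 fun _ => 1 / 2, interior_maximal (fun u hu i => ?_) hopen ?_⟩
  · exact Ioo_subset_Ico_self (hu i)
  · intro i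
    norm_num

/-- Choosing binary block digits for each coordinate and re-reading them in base `b` embeds the unit
cube into `stdProd`. The inverse is `η`-Hölder, so `n ≤ dimH / η`. -/
lemma mul_le_dimH_stdProd (hn : 0 < n) {θ η : ℝ} (hη : 0 < η) (hηθ : η < θ)
    (hb : b = 2 ^ (-1 / θ)) (h1 : b ≤ 1 / 2) :
    ENNReal.ofReal (n * η) ≤ dimH (stdProd n b univ) := by
  obtain ⟨C, hC0, hC⟩ := exists_holder_bound hη hηθ hb h1
  set Q : Set (EuclideanSpace ℝ (Fin n)) := {u | ∀ i, u i ∈ Ico (0 : ℝ) 1} with hQ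
  have hdig : ∀ u : ℝ, ∃ e : ℕ → ℤ, (∀ j, e j ∈ stdDigits univ j) ∧
      (u ∈ Ico (0 : ℝ) 1 → digitSum (1 / 2) e = u) := fun u => by
    by_cases hu : u ∈ Ico (0 : ℝ) 1
    · obtain ⟨e, he, hs⟩ := Ico_subset_digitSet hu
      exact ⟨e, he, fun _ => hs⟩
    · exact ⟨fun _ => 0, zero_mem_stdDigits _, fun h => absurd h hu⟩
  choose e he hs using hdig
  set G : EuclideanSpace ℝ (Fin n) → EuclideanSpace ℝ (Fin n) :=
    fun u => WithLp.toLp 2 fun i => digitSum b (e (u i)) with hG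
  have hGdist : ∀ u ∈ Q, ∀ v ∈ Q, dist u v ≤ √n * C * dist (G u) (G v) ^ η := by
    intro u hu v hv
    rw [mul_assoc]
    refine EuclideanSpace.dist_le_sqrt_mul (by positivity) fun i => ?_
    have h2 := hC (e (u i)) (e (v i)) (he _) (he _)
    rw [hs _ (hu i), hs _ (hv i)] at h2
    refine h2.trans (mul_le_mul_of_nonneg_left (Real.rpow_le_rpow (abs_nonneg _) ?_ hη.le) hC0)
    exact EuclideanSpace.dist_coord_le (G u) (G v) i
  have hinj : InjOn G Q := fun u hu v hv huv => by
    have := hGdist u hu v hv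
    rw [huv, dist_self, Real.zero_rpow hη.ne', mul_zero] at this
    exact dist_le_zero.1 this
  have hleft := hinj.leftInvOn_invFunOn
  have himg : Function.invFunOn G Q '' (G '' Q) = Q := hleft.image_image
  have hholder : HolderOnWith (√n * C).toNNReal η.toNNReal (Function.invFunOn G Q) (G '' Q) := by
    rintro _ ⟨u, hu, rfl⟩ _ ⟨v, hv, rfl⟩
    rw [hleft hu, hleft hv, Real.coe_toNNReal _ hη.le, edist_dist, edist_dist,
      ENNReal.ofReal_rpow_of_nonneg dist_nonneg hη.le]
    change _ ≤ ENNReal.ofReal (√n * C) * _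
    rw [← ENNReal.ofReal_mul (by positivity)]
    exact ENNReal.ofReal_le_ofReal (hGdist u hu v hv)
  have hdim := hholder.dimH_image_le (Real.toNNReal_pos.2 hη)
  rw [himg, dimH_unitCube] at hdim
  have hsub : G '' Q ⊆ stdProd n b univ := by
    rintro _ ⟨u, -, rfl⟩ i
    exact ⟨e (u i), he _, rfl⟩
  rw [ENNReal.le_div_iff_mul_le (by simp [hη]) (by simp)] at hdim
  refine le_trans (le_of_eq ?_) (hdim.trans (dimH_mono hsub))
  rw [ENNReal.ofReal_mul (Nat.cast_nonneg _), ENNReal.ofReal_natCast]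
  rfl

lemma le_dimH_stdProd (hn : 0 < n) {θ : ℝ}
    (hb : b = 2 ^ (-1 / θ)) (h1 : b ≤ 1 / 2) :
    ENNReal.ofReal (n * θ) ≤ dimH (stdProd n b univ) := by
  have hn' : (0 : ℝ) < n := by exact_mod_cast hn
  refine le_of_forall_lt_imp_le_of_dense fun a ha => ?_
  lift a to ℝ≥0 using (ha.trans ENNReal.ofReal_lt_top).ne with d
  have hd : (d : ℝ) < n * θ := by
    rw [← ENNReal.ofReal_coe_nnreal] at ha
    exact (ENNReal.ofReal_lt_ofReal_iff_of_nonneg d.coe_nonneg).1 ha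
  obtain ⟨η, hη1, hη2⟩ := exists_between (show (d : ℝ) / n < θ by
    rw [div_lt_iff₀ hn']; linarith)
  have hη : 0 < η := lt_of_le_of_lt (by positivity) hη1
  refine le_trans ?_ (mul_le_dimH_stdProd hn hη hη2 hb h1)
  rw [← ENNReal.ofReal_coe_nnreal]
  refine ENNReal.ofReal_le_ofReal ?_
  rw [div_lt_iff₀ hn'] at hη1
  linarith

end HausdorffDimension

/-! ### Unions of shrinking pieces -/

section ScaledUnions

open scoped Pointwise

lemma isCompact_insert_iUnion {X : Type*} [PseudoMetricSpace X] {x : X} {K : ℕ → Set X}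
    {r : ℕ → ℝ} (hK : ∀ J, IsCompact (K J)) (hr : ∀ J, K J ⊆ Metric.closedBall x (r J))
    (hlim : Tendsto r atTop (𝓝 0)) : IsCompact (insert x (⋃ J, K J)) := by
  classical
  refine isCompact_of_finite_subcover fun {ι} U hU hcov => ?_
  obtain ⟨i₀, hi₀⟩ := mem_iUnion.1 (hcov (mem_insert _ _))
  obtain ⟨ρ, hρ, hball⟩ := Metric.isOpen_iff.1 (hU i₀) x hi₀
  obtain ⟨J₀, hJ₀⟩ := eventually_atTop.1 (hlim.eventually_lt_const hρ)
  have hfin : IsCompact (⋃ J ∈ Finset.range J₀, K J) :=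
    (Finset.range J₀).isCompact_biUnion fun J _ => hK J
  obtain ⟨t, ht⟩ := hfin.elim_finite_subcover U hU
    ((iUnion₂_subset fun J _ => subset_iUnion K J).trans ((subset_insert _ _).trans hcov))
  refine ⟨insert i₀ t, ?_⟩
  rintro y (rfl | hy)
  · exact mem_iUnion₂.2 ⟨i₀, Finset.mem_insert_self _ _, hi₀⟩
  · obtain ⟨J, hJ⟩ := mem_iUnion.1 hy
    rcases lt_or_ge J J₀ with h | h
    · obtain ⟨i, hi, hyi⟩ := mem_iUnion₂.1
        (ht (mem_iUnion₂.2 ⟨J, Finset.mem_range.2 h, hJ⟩))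
      exact mem_iUnion₂.2 ⟨i, Finset.mem_insert_of_mem hi, hyi⟩
    · refine mem_iUnion₂.2 ⟨i₀, Finset.mem_insert_self _ _, hball ?_⟩
      exact Metric.closedBall_subset_ball (hJ₀ J h) (hr J hJ)

/-- The size of the `J`-th piece. -/
def pieceScale (τ : ℝ) (J : ℕ) : ℝ := 2 ^ (-((1 - τ) / τ * tri J))

lemma pieceScale_pos (τ : ℝ) (J : ℕ) : 0 < pieceScale τ J := Real.rpow_pos_of_pos two_pos _

variable {τ : ℝ}

lemma summable_pieceScale_rpow (h0 : 0 < τ) (h1 : τ < 1) {η : ℝ} (hη : 0 < η) :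
    Summable fun J => pieceScale τ J ^ η := by
  set q : ℝ := 2 ^ (-((1 - τ) / τ * η)) with hq
  have hpos : 0 < (1 - τ) / τ * η := mul_pos (div_pos (by linarith) h0) hη
  have hq0 : 0 < q := Real.rpow_pos_of_pos two_pos _
  have hq1 : q < 1 := Real.rpow_lt_one_of_one_lt_of_neg one_lt_two (by linarith)
  have hterm : ∀ J, pieceScale τ J ^ η = q ^ tri J := fun J => by
    rw [pieceScale, hq, ← Real.rpow_natCast, ← Real.rpow_mul two_pos.le, ← Real.rpow_mul two_pos.le]
    congr 1
    ring
  simp only [hterm]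
  rw [← summable_nat_add_iff 1]
  exact Summable.of_nonneg_of_le (fun J => by positivity)
    (fun J => pow_le_pow_of_le_one hq0.le hq1.le (le_tri_succ J))
    (summable_geometric_of_lt_one hq0.le hq1)

lemma tendsto_pieceScale (h0 : 0 < τ) (h1 : τ < 1) :
    Tendsto (pieceScale τ) atTop (𝓝 0) := by
  simpa using (summable_pieceScale_rpow h0 h1 one_pos).tendsto_atTop_zero

variable {E : Type*} [NormedAddCommGroup E] [NormedSpace ℝ E]

lemma Covers.smul {A : Set E} {ε N c : ℝ} (h : Covers A ε N) (hc : 0 < c) :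
    Covers (c • A) (c * ε) N := by
  have := h.image hc.le (fun x : E => c • x) fun x y => by
    rw [dist_smul₀, Real.norm_of_nonneg hc.le]
  rwa [image_smul] at this

lemma exists_covers_closedBall [ProperSpace E] (R : ℝ) :
    ∃ N : ℝ, ∀ ε : ℝ, 0 < ε → Covers (Metric.closedBall (0 : E) (R * ε)) ε N := by
  obtain ⟨t, -, ht, hcov⟩ := (isCompact_closedBall (0 : E) R).finite_cover_balls one_pos
  refine ⟨ht.toFinset.card, fun ε hε => ?_⟩
  have h1 : Covers (Metric.closedBall (0 : E) R) 1 ht.toFinset.card :=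
    ⟨ht.toFinset, le_rfl, hcov.trans (by
      simpa using iUnion₂_mono fun x _ => Metric.ball_subset_closedBall)⟩
  refine (h1.smul hε).mono ?_ (by rw [mul_one]) le_rfl
  rw [smul_closedBall' hε.ne', smul_zero, Real.norm_of_nonneg hε.le, mul_comm]

/-- The case in which the mesh of the piece is at most `ε`. Part of the factor `L ^ u'` is traded
for a power of `ε`; the remaining `L ^ η` makes the bounds summable over `J`. -/
lemma piece_bound_large {u' t' η ε : ℝ} (h0 : 0 < τ) (hη : 0 < η)
    (hu' : η ≤ u') (ht : τ * u' + η ≤ t') (hε : 0 < ε) (hε1 : ε ≤ 1) {J : ℕ}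
    (hJ : pieceScale τ J ≤ ε ^ (1 - τ)) :
    (ε / pieceScale τ J) ^ (-u') ≤ pieceScale τ J ^ η * ε ^ (-t') := by
  set L := pieceScale τ J with hLdef
  have hL : 0 < L := pieceScale_pos τ J
  calc (ε / L) ^ (-u') = ε ^ (-u') * (L ^ η * L ^ (u' - η)) := by
        rw [Real.div_rpow hε.le hL.le, ← Real.rpow_add hL, add_sub_cancel, Real.rpow_neg hL.le]
        field_simp
    _ ≤ ε ^ (-u') * (L ^ η * (ε ^ (1 - τ)) ^ (u' - η)) := by
        gcongr
    _ = L ^ η * ε ^ (-u' + (1 - τ) * (u' - η)) := by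
        rw [← Real.rpow_mul hε.le, Real.rpow_add hε]; ring
    _ ≤ L ^ η * ε ^ (-t') := by
        refine mul_le_mul_of_nonneg_left ?_ (by positivity)
        refine Real.rpow_le_rpow_of_exponent_ge hε hε1 ?_
        nlinarith

/-- The case in which the mesh `δ` is at least `ε`. Everything is expressed through `δ`, using
`pieceScale τ J = δ ^ (1 - τ)`; `k ≤ t'` then allows the leftover power of `δ` to be replaced by one
of `ε`. -/
lemma piece_bound_small {u' t' k η ε : ℝ} (h0 : 0 < τ) (hη : 0 < η)
    (ht : τ * u' + η ≤ t') (htk : k ≤ t') (hε : 0 < ε) {J : ℕ}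
    (hJ : ε ^ (1 - τ) ≤ pieceScale τ J) (h1 : τ < 1) :
    2 ^ ((u' - k) * tri J) * (ε / pieceScale τ J) ^ (-k) ≤ pieceScale τ J ^ η * ε ^ (-t') := by
  set δ : ℝ := 2 ^ (-(tri J / τ)) with hδdef
  have hδ : 0 < δ := Real.rpow_pos_of_pos two_pos _
  have hδ1 : δ ≤ 1 := Real.rpow_le_one_of_one_le_of_nonpos one_le_two
    (by have : 0 ≤ (tri J : ℝ) / τ := by positivity
        linarith)
  have hL : pieceScale τ J = δ ^ (1 - τ) := by
    rw [pieceScale, hδdef, ← Real.rpow_mul two_pos.le]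
    congr 1
    field_simp
  have hpow : (2 : ℝ) ^ ((u' - k) * tri J) = δ ^ (-(τ * (u' - k))) := by
    rw [hδdef, ← Real.rpow_mul two_pos.le]
    congr 1
    field_simp
  rw [hL] at hJ ⊢
  have hεδ : ε ≤ δ := (Real.rpow_le_rpow_iff hε.le hδ.le (by linarith : 0 < 1 - τ)).1 hJ
  rw [hpow, Real.div_rpow hε.le (by positivity), ← Real.rpow_mul hδ.le, ← Real.rpow_mul hδ.le]
  calc δ ^ (-(τ * (u' - k))) * (ε ^ (-k) / δ ^ ((1 - τ) * -k))
      = δ ^ (k - τ * u') * ε ^ (-k) := by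
        rw [mul_div_assoc', mul_comm (δ ^ _), mul_div_assoc, ← Real.rpow_sub hδ, mul_comm]
        congr 2
        ring
    _ ≤ δ ^ ((1 - τ) * η + (k - t')) * ε ^ (-k) := by
        refine mul_le_mul_of_nonneg_right ?_ (by positivity)
        refine Real.rpow_le_rpow_of_exponent_ge hδ hδ1 ?_
        nlinarith
    _ = δ ^ ((1 - τ) * η) * δ ^ (k - t') * ε ^ (-k) := by rw [Real.rpow_add hδ]
    _ ≤ δ ^ ((1 - τ) * η) * ε ^ (k - t') * ε ^ (-k) := by
        refine mul_le_mul_of_nonneg_right (mul_le_mul_of_nonneg_left ?_ (by positivity))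
          (by positivity)
        exact Real.rpow_le_rpow_of_nonpos hε hεδ (by linarith)
    _ = _ := by
        rw [mul_assoc, ← Real.rpow_add hε]
        congr 2
        ring

/-- The box dimension of a union of scaled copies of sets that look `u`-dimensional at large and
`k`-dimensional at small scales. -/
lemma coverBound_insert_iUnion_smul [ProperSpace E] {W : ℕ → Set E} {R u k : ℝ}
    (h0 : 0 < τ) (h1 : τ < 1) (hR : 0 ≤ R) (hu : 0 ≤ u) (hW : ∀ J, W J ⊆ Metric.closedBall 0 R)
    (hcov : ∀ u' > u, ∃ C : ℝ, ∀ J ρ, 0 < ρ → ρ ≤ 1 → Covers (W J) ρ (C * ρ ^ (-u')) ∧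
      Covers (W J) ρ (C * 2 ^ ((u' - k) * tri J) * ρ ^ (-k))) :
    CoverBound (insert 0 (⋃ J, pieceScale τ J • W J)) (max k (u * τ)) := by
  intro t' ht'
  obtain ⟨hkt, hut⟩ := max_lt_iff.1 ht'
  -- Half of the slack pays for raising `u` to `u + η / τ`, the other half for the summable factor
  -- `pieceScale τ J ^ η`.
  set η := (t' - u * τ) / 2 with hη
  have hη0 : 0 < η := by rw [hη]; linarith
  have huη : η ≤ u + η / τ := by
    have : η ≤ η / τ := by rw [le_div_iff₀ h0]; nlinarith
    linarith
  have hτu : τ * (u + η / τ) + η ≤ t' := by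
    rw [mul_add, mul_div_cancel₀ _ h0.ne', hη]; linarith
  obtain ⟨C, hC⟩ := hcov (u + η / τ) (by have := div_pos hη0 h0; linarith)
  have hC0 : 0 ≤ C := by simpa using (hC 0 1 one_pos le_rfl).1.nonneg
  obtain ⟨N, hN⟩ := exists_covers_closedBall (E := E) R
  have hN0 : 0 ≤ N := (hN 1 one_pos).nonneg
  have hsum := summable_pieceScale_rpow h0 h1 hη0
  have ht0 : 0 ≤ t' := by
    have := mul_nonneg hu h0.le
    linarith
  refine ⟨C * (∑' J, pieceScale τ J ^ η) + N, fun ε hε hε1 => ?_⟩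
  have hpiece : ∀ J, ε ≤ pieceScale τ J →
      Covers (pieceScale τ J • W J) ε (C * (pieceScale τ J ^ η * ε ^ (-t'))) := by
    intro J hJ
    have hL := pieceScale_pos τ J
    obtain ⟨hc1, hc2⟩ := hC J (ε / pieceScale τ J) (by positivity) ((div_le_one hL).2 hJ)
    rcases le_total (pieceScale τ J) (ε ^ (1 - τ)) with h | h
    · refine (hc1.smul hL).mono subset_rfl (mul_div_cancel₀ _ hL.ne').le ?_
      exact mul_le_mul_of_nonneg_left (piece_bound_large h0 hη0 huη hτu hε hε1 h) hC0
    · refine (hc2.smul hL).mono subset_rfl (mul_div_cancel₀ _ hL.ne').le ?_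
      rw [mul_assoc]
      exact mul_le_mul_of_nonneg_left (piece_bound_small h0 hη0 hτu hkt.le hε h h1) hC0
  classical
  -- Only finitely many pieces have scale at least `ε`; all others lie in the ball of radius `R *
  -- ε`, which needs `N` balls whatever `ε` is.
  obtain ⟨J₀, hJ₀⟩ := eventually_atTop.1 ((tendsto_pieceScale h0 h1).eventually_lt_const hε)
  have hbig := Covers.biUnion ((Finset.range J₀).filter fun J => ε ≤ pieceScale τ J)
    fun J hJ => hpiece J (Finset.mem_filter.1 hJ).2
  refine (hbig.union (hN ε hε)).mono ?_ le_rfl ?_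
  · have hRε : ∀ J, pieceScale τ J < ε → pieceScale τ J • W J ⊆
        Metric.closedBall 0 (R * ε) := by
      rintro J hJ _ ⟨y, hy, rfl⟩
      have h2 := hW J hy
      rw [mem_closedBall_zero_iff] at h2 ⊢
      simp only
      rw [norm_smul, Real.norm_of_nonneg (pieceScale_pos τ J).le, mul_comm]
      exact mul_le_mul h2 hJ.le (pieceScale_pos τ J).le ((norm_nonneg _).trans h2)
    rintro y (rfl | hy)
    · exact Or.inr (by simpa using mul_nonneg hR hε.le)
    · obtain ⟨J, hJ⟩ := mem_iUnion.1 hy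
      rcases lt_or_ge (pieceScale τ J) ε with h | h
      · exact Or.inr (hRε J h hJ)
      · refine Or.inl (mem_iUnion₂.2 ⟨J, Finset.mem_filter.2 ⟨?_, h⟩, hJ⟩)
        rw [Finset.mem_range]
        by_contra! hle
        exact absurd (hJ₀ J hle) (not_lt.2 h)
  · have hpow : 1 ≤ ε ^ (-t') := Real.one_le_rpow_of_pos_of_le_one_of_nonpos hε hε1 (by linarith)
    have h3 : ∑ J ∈ (Finset.range J₀).filter fun J => ε ≤ pieceScale τ J,
        pieceScale τ J ^ η ≤ ∑' J, pieceScale τ J ^ η :=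
      hsum.sum_le_tsum _ fun J _ => Real.rpow_nonneg (pieceScale_pos τ J).le _
    rw [← Finset.mul_sum, ← Finset.sum_mul, add_mul, mul_assoc]
    refine add_le_add (mul_le_mul_of_nonneg_left
      (mul_le_mul_of_nonneg_right h3 (by positivity)) hC0) ?_
    exact le_mul_of_one_le_right hN0 hpow

end ScaledUnions

/-! ### The two constructions -/

section Constructions

open scoped Pointwise

variable {n k : ℕ}

lemma coverBound_of_covers_const {X : Type*} [PseudoMetricSpace X] {A : Set X} {C t : ℝ}
    (h : ∀ ε : ℝ, 0 < ε → ε ≤ 1 → Covers A ε (C * ε ^ (-t))) : CoverBound A t := fun t' ht => by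
  have hC0 : 0 ≤ C := by simpa using (h 1 one_pos le_rfl).nonneg
  refine ⟨C, fun ε h0 h1 => (h ε h0 h1).mono subset_rfl le_rfl ?_⟩
  exact mul_le_mul_of_nonneg_left
    (Real.rpow_le_rpow_of_exponent_ge h0 h1 (by linarith)) hC0

lemma half_eq : (1 / 2 : ℝ) = 2 ^ (-1 / (1 : ℝ)) := by
  rw [div_one, Real.rpow_neg_one, one_div]

lemma two_rpow_neg_le_half {θ : ℝ} (h0 : 0 < θ) (h1 : θ ≤ 1) : (2 : ℝ) ^ (-1 / θ) ≤ 1 / 2 := by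
  rw [half_eq]
  refine Real.rpow_le_rpow_of_exponent_le one_le_two ?_
  rw [div_le_div_iff₀ h0 one_pos]
  linarith

/-- Supplies the set adjoined to the skeleton sets to force the lower bounds. Dimension `0` is
separate because the base `2 ^ (-1 / θ)` calls for `θ > 0`. -/
lemma exists_isCompact_dim_eq (hn : 0 < n) {t : ℝ} (ht : t ∈ Icc (0 : ℝ) n) :
    ∃ D : Set (EuclideanSpace ℝ (Fin n)), IsCompact D ∧ D.Nonempty ∧ CoverBound D t ∧
      ENNReal.ofReal t ≤ dimH D := by
  have hn' : (0 : ℝ) < n := by exact_mod_cast hn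
  rcases ht.1.eq_or_lt with rfl | h0
  · refine ⟨{0}, isCompact_singleton, singleton_nonempty _, ?_, by simp⟩
    exact coverBound_of_covers_const (C := 1) fun ε h0 _ => by
      simpa using Covers.singleton (0 : EuclideanSpace ℝ (Fin n)) h0.le
  · have hθ : 0 < t / n := by positivity
    have hb0 : (0 : ℝ) < 2 ^ (-1 / (t / n)) := Real.rpow_pos_of_pos two_pos _
    have hb1 := two_rpow_neg_le_half hθ ((div_le_one hn').2 ht.2)
    have hnt : n * (t / n) = t := mul_div_cancel₀ _ hn'.ne'
    have h1 := coverBound_stdProd hn hθ rfl hb1 univ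
    have h2 := le_dimH_stdProd hn (θ := t / n) rfl hb1
    rw [hnt] at h1 h2
    exact ⟨stdProd n _ univ, isCompact_stdProd n hb0 hb1 univ, ⟨0, zero_mem_stdProd n _ _⟩, h1, h2⟩

lemma ContainsSkeletonAroundEach.mono {B B' S : Set (EuclideanSpace ℝ (Fin n))}
    (h : ContainsSkeletonAroundEach k B S) (hB : B ⊆ B') : ContainsSkeletonAroundEach k B' S :=
  fun x hx => by
    obtain ⟨r, hr, hsub⟩ := h x hx
    exact ⟨r, hr, hsub.trans hB⟩

/-- The exponent in the packing dimension case, as the dimension of the constructed plates. -/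
lemma packing_exponent_eq (hk : k < n) (s : ℝ) :
    (k : ℝ) + ((n : ℝ) - k) * (2 * n - 1) / (2 * (n : ℝ) ^ 2) * s =
      k + (n - k) * (s / n) * (1 - 1 / (2 * n : ℝ)) := by
  have hn : (n : ℝ) ≠ 0 := by exact_mod_cast (by omega : n ≠ 0)
  field_simp

lemma packing_exponent_mem (hk : k < n) {s : ℝ} (hs : s ∈ Icc (0 : ℝ) n) :
    (k : ℝ) + ((n : ℝ) - k) * (2 * n - 1) / (2 * (n : ℝ) ^ 2) * s ∈ Icc (0 : ℝ) n := by
  have hn : (1 : ℝ) ≤ n := by exact_mod_cast (by omega : 1 ≤ n)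
  have hnk : (0 : ℝ) ≤ n - k := sub_nonneg.2 (by exact_mod_cast hk.le)
  rw [packing_exponent_eq hk]
  have h1 : 0 ≤ s / n := div_nonneg hs.1 (by linarith)
  have h2 : s / n ≤ 1 := (div_le_one (by linarith)).2 hs.2
  have h3 : 1 / (2 * n : ℝ) ≤ 1 := (div_le_one (by linarith)).2 (by linarith)
  have h4 : 0 ≤ 1 / (2 * n : ℝ) := by positivity
  have h5 : s / n * (1 - 1 / (2 * n : ℝ)) ≤ 1 := mul_le_one₀ h2 (by linarith) (by linarith)
  have h6 : 0 ≤ s / n * (1 - 1 / (2 * n : ℝ)) := mul_nonneg h1 (by linarith)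
  have hk0 : (0 : ℝ) ≤ k := Nat.cast_nonneg _
  rw [mul_assoc]
  constructor <;> nlinarith

lemma exists_homogeneous_construction (hk : k < n) {s : ℝ} (hs : s ∈ Icc (0 : ℝ) n) :
    ∃ S B : Set (EuclideanSpace ℝ (Fin n)), IsCompact S ∧ IsCompact B ∧ S.Nonempty ∧ B.Nonempty ∧
      ContainsSkeletonAroundEach k B S ∧ CoverBound S s ∧ ENNReal.ofReal s ≤ dimH S ∧
      CoverBound B ((k : ℝ) + ((n : ℝ) - k) * (2 * n - 1) / (2 * (n : ℝ) ^ 2) * s) ∧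
      ENNReal.ofReal ((k : ℝ) + ((n : ℝ) - k) * (2 * n - 1) / (2 * (n : ℝ) ^ 2) * s) ≤
        dimH B := by
  have hn : 0 < n := by omega
  have hn' : (0 : ℝ) < n := by exact_mod_cast hn
  obtain ⟨D, hDc, hDne, hDub, hDlb⟩ := exists_isCompact_dim_eq hn (packing_exponent_mem hk hs)
  rcases hs.1.eq_or_lt with rfl | h0
  · have hb0 : (0 : ℝ) < 1 / 2 := by norm_num
    -- For `s = 0` no digits are used (`Iio 0`), so the centres reduce to the origin and, as `tri 0
    -- = 0`, the skeleton set has covering exponent `k`.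
    obtain ⟨C, -, hC⟩ := exists_covers_stdProd hn one_pos half_eq le_rfl one_lt_two
    obtain ⟨C', -, hC'⟩ := exists_covers_skelSet hk one_pos half_eq le_rfl
      (v := 1) (by rw [sub_lt_self_iff]; positivity)
    refine ⟨stdProd n (1 / 2) (Iio 0), skelSet n k (1 / 2) (Iio 0) ∪ D,
      isCompact_stdProd n hb0 le_rfl _, (isCompact_skelSet n k hb0 le_rfl _).union hDc,
      ⟨0, zero_mem_stdProd n _ _⟩, hDne.inr,
      (containsSkeletonAroundEach_skelSet hb0 le_rfl _).mono subset_union_left, ?_, by simp, ?_,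
      hDlb.trans (dimH_mono subset_union_right)⟩
    · exact coverBound_of_covers_const fun ε h1 h2 => by simpa using hC 0 ε h1 h2
    · refine CoverBound.union ?_ hDub
      rw [mul_zero, add_zero]
      exact coverBound_of_covers_const fun ε h1 h2 => by simpa using hC' 0 ε h1 h2
  · have hθ : 0 < s / n := by positivity
    have hb0 : (0 : ℝ) < 2 ^ (-1 / (s / n)) := Real.rpow_pos_of_pos two_pos _
    have hb1 := two_rpow_neg_le_half hθ ((div_le_one hn').2 hs.2)
    have hns : n * (s / n) = s := mul_div_cancel₀ _ hn'.ne'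
    have h1 := coverBound_stdProd hn hθ rfl hb1 univ
    have h2 := le_dimH_stdProd hn (θ := s / n) rfl hb1
    have h3 := coverBound_skelSet hk hθ rfl hb1 univ
    rw [← packing_exponent_eq hk] at h3
    rw [hns] at h1 h2
    exact ⟨stdProd n _ univ, skelSet n k _ univ ∪ D, isCompact_stdProd n hb0 hb1 univ,
      (isCompact_skelSet n k hb0 hb1 _).union hDc, ⟨0, zero_mem_stdProd n _ _⟩, hDne.inr,
      (containsSkeletonAroundEach_skelSet hb0 hb1 _).mono subset_union_left, h1, h2, h3.union hDub,
      hDlb.trans (dimH_mono subset_union_right)⟩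

lemma norm_le_of_forall_abs_le {R : ℝ} (hR : 0 ≤ R) {y : EuclideanSpace ℝ (Fin n)}
    (h : ∀ i, |y i| ≤ R) : ‖y‖ ≤ √n * R := by
  rw [← dist_zero_right]
  exact EuclideanSpace.dist_le_sqrt_mul hR fun i => by simpa using h i

lemma stdProd_subset_closedBall {b : ℝ} (h0 : 0 < b) (h1 : b ≤ 1 / 2) (H : Set ℕ) :
    stdProd n b H ⊆ Metric.closedBall 0 (√n * 4) := fun y hy =>
  mem_closedBall_zero_iff.2 (norm_le_of_forall_abs_le (by norm_num) fun i =>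
    (abs_le_of_mem_digitSet_stdDigits h0 h1 (hy i)).trans (by norm_num))

lemma skelSet_subset_closedBall {b : ℝ} (h0 : 0 < b) (h1 : b ≤ 1 / 2) (H : Set ℕ) :
    skelSet n k b H ⊆ Metric.closedBall 0 (√n * 4) := by
  rintro y ⟨I, -, hy⟩
  refine mem_closedBall_zero_iff.2 (norm_le_of_forall_abs_le (by norm_num) fun i => ?_)
  by_cases hi : i ∈ I
  · exact (hy i).1 hi
  · rcases (hy i).2 hi with ⟨a, ha, hya⟩ | ⟨a, ha, hya⟩
    · have := abs_le.1 (abs_le_of_mem_gapSet h0 h1 ha)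
      rw [← hya, abs_le]
      constructor <;> linarith
    · have := abs_le.1 (abs_le_of_mem_gapSet h0 h1 ha)
      rw [← hya, abs_le]
      constructor <;> linarith

lemma cubeSkeleton_smul_subset {x : EuclideanSpace ℝ (Fin n)} {r c : ℝ} (hc : 0 < c) :
    cubeSkeleton k (c • x) (c * r) ⊆ c • cubeSkeleton k x r := by
  rintro y ⟨I, hI, hy⟩
  refine ⟨c⁻¹ • y, ⟨I, hI, fun i => ?_⟩, smul_inv_smul₀ hc.ne' y⟩
  have hval : y i = c * (c⁻¹ • y) i := by simp [hc.ne']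
  have h := hy i
  rw [hval] at h
  simp only [PiLp.smul_apply, smul_eq_mul, mem_Icc, mem_insert_iff, mem_singleton_iff] at h ⊢
  set z := c⁻¹ * y i
  rw [← mul_sub, ← mul_add] at h
  rwa [mul_le_mul_iff_right₀ hc, mul_le_mul_iff_right₀ hc, mul_right_inj' hc.ne',
    mul_right_inj' hc.ne'] at h

/-- The union of scaled copies of finite sets of centres, accumulating at the origin. -/
def multiscale (τ : ℝ) (W : ℕ → Set (EuclideanSpace ℝ (Fin n))) : Set (EuclideanSpace ℝ (Fin n)) :=
  insert 0 (⋃ J, pieceScale τ J • W J)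

variable {τ : ℝ}

lemma isCompact_multiscale (h0 : 0 < τ) (h1 : τ < 1) {W : ℕ → Set (EuclideanSpace ℝ (Fin n))}
    {R : ℝ} (hW : ∀ J, IsCompact (W J)) (hR : ∀ J, W J ⊆ Metric.closedBall 0 R) :
    IsCompact (multiscale τ W) := by
  refine isCompact_insert_iUnion (r := fun J => pieceScale τ J * R) (fun J => (hW J).smul _)
    (fun J => ?_) (by simpa using (tendsto_pieceScale h0 h1).mul_const R)
  rw [← Real.norm_of_nonneg (pieceScale_pos τ J).le, Real.norm_of_nonneg (pieceScale_pos τ J).le]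
  rintro _ ⟨y, hy, rfl⟩
  have := mem_closedBall_zero_iff.1 (hR J hy)
  rw [mem_closedBall_zero_iff]
  simp only
  rw [norm_smul, Real.norm_of_nonneg (pieceScale_pos τ J).le]
  exact mul_le_mul_of_nonneg_left this (pieceScale_pos τ J).le

lemma containsSkeletonAroundEach_multiscale {b : ℝ} (h0 : 0 < b) (h1 : b ≤ 1 / 2) :
    ContainsSkeletonAroundEach k (multiscale τ fun J => skelSet n k b (Iio J))
      (multiscale τ fun J => stdProd n b (Iio J)) := by
  have key : ∀ J, ∀ y ∈ stdProd n b (Iio J), ∃ r : ℝ, 0 < r ∧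
      cubeSkeleton k (pieceScale τ J • y) r ⊆ multiscale τ fun J => skelSet n k b (Iio J) := by
    intro J y hy
    obtain ⟨r, hr, hsub⟩ := exists_cubeSkeleton_subset (k := k) h0 h1 hy
    have hL := pieceScale_pos τ J
    refine ⟨pieceScale τ J * r, by positivity, (cubeSkeleton_smul_subset hL).trans ?_⟩
    exact (smul_set_mono hsub).trans ((subset_iUnion
      (fun J => pieceScale τ J • skelSet n k b (Iio J)) J).trans (subset_insert _ _))
  rintro x (rfl | hx)
  -- The accumulation point already belongs to a piece, so it inherits that piece's skeleton.
  · have := key 0 0 (zero_mem_stdProd n b _)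
    rwa [smul_zero] at this
  · obtain ⟨J, y, hy, rfl⟩ := mem_iUnion.1 hx
    exact key J y hy

lemma coverBound_multiscale_stdProd (hn : 0 < n) (h0 : 0 < τ) (h1 : τ < 1) :
    CoverBound (multiscale τ fun J => stdProd n (1 / 2) (Iio J)) (n * τ) := by
  have hn' : (0 : ℝ) < n := by exact_mod_cast hn
  have h := coverBound_insert_iUnion_smul (W := fun J => stdProd n (1 / 2) (Iio J))
    (R := √n * 4) (u := n) (k := 0) h0 h1 (by positivity) (by positivity)
    (fun J => stdProd_subset_closedBall (by norm_num) le_rfl _) fun u' hu' => by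
      obtain ⟨C, hC1, hC2⟩ := exists_covers_stdProd hn one_pos half_eq le_rfl
        ((one_lt_div hn').2 hu')
      refine ⟨C, fun J ρ hρ hρ1 => ⟨?_, ?_⟩⟩
      · have := hC1 (Iio J) ρ hρ hρ1
        rwa [mul_one, mul_div_cancel₀ _ hn'.ne'] at this
      · have := hC2 J ρ hρ hρ1
        rw [mul_div_cancel₀ _ hn'.ne'] at this
        simpa using this
  rwa [max_eq_right (by positivity)] at h

lemma coverBound_multiscale_skelSet (hk : k < n) (h0 : 0 < τ) (h1 : τ < 1) :
    CoverBound (multiscale τ fun J => skelSet n k (1 / 2) (Iio J))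
      (max (k : ℝ) ((k + (n - k) * (1 - 1 / (2 * n : ℝ))) * τ)) := by
  have hn1 : (1 : ℝ) ≤ n := by exact_mod_cast (by omega : 1 ≤ n)
  have hnk : (0 : ℝ) < n - k := sub_pos.2 (by exact_mod_cast hk)
  have hc : 0 ≤ 1 - 1 / (2 * n : ℝ) := by
    rw [sub_nonneg, div_le_one (by linarith)]; linarith
  refine coverBound_insert_iUnion_smul (W := fun J => skelSet n k (1 / 2) (Iio J))
    (R := √n * 4) (k := k) h0 h1 (by positivity) (by positivity)
    (fun J => skelSet_subset_closedBall (by norm_num) le_rfl _) fun u' hu' => ?_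
  obtain ⟨C, hC1, hC2⟩ := exists_covers_skelSet (v := (u' - k) / (n - k)) hk one_pos half_eq le_rfl
    (by rw [lt_div_iff₀ hnk]; linarith)
  refine ⟨C, fun J ρ hρ hρ1 => ⟨?_, ?_⟩⟩
  · have := hC1 (Iio J) ρ hρ hρ1
    rwa [mul_one, mul_div_cancel₀ _ hnk.ne', add_sub_cancel] at this
  · have := hC2 J ρ hρ hρ1
    rwa [mul_div_cancel₀ _ hnk.ne'] at this

lemma pieceScale_div_eq (h0 : 0 < τ) (J : ℕ) :
    pieceScale τ J / 2 ^ tri J = 2 ^ (-(tri J / τ)) := by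
  rw [pieceScale, ← Real.rpow_natCast, ← Real.rpow_sub two_pos]
  congr 1
  field_simp
  ring

/-- The `J`-th piece contains a full grid of `2 ^ (n * tri J)` points with spacing `2 ^ (-tri J / τ)
> 2 * ε`, and no ball of radius `ε` holds two of them. -/
lemma two_pow_mul_tri_le_of_covers (h0 : 0 < τ) {J : ℕ} {ε N : ℝ}
    (hε : 2 * ε < 2 ^ (-(tri J / τ)))
    (h : Covers (multiscale (n := n) τ fun J => stdProd n (1 / 2) (Iio J)) ε N) :
    (2 : ℝ) ^ ((n : ℝ) * tri J) ≤ N := by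
  classical
  obtain ⟨F, hF, hcov⟩ := h
  set P : (Fin n → Fin (2 ^ tri J)) → EuclideanSpace ℝ (Fin n) := fun m =>
    pieceScale τ J • WithLp.toLp 2 fun i => ((m i : ℕ) : ℝ) / 2 ^ tri J with hP
  have hmem : ∀ m, P m ∈ multiscale τ fun J => stdProd n (1 / 2) (Iio J) := fun m =>
    Or.inr (mem_iUnion.2 ⟨J, _, fun i => dyadic_mem_digitSet J _ (m i).2, rfl⟩)
  have hex : ∀ m, ∃ c ∈ F, dist (P m) c ≤ ε := fun m => by
    obtain ⟨c, hc, hmc⟩ := mem_iUnion₂.1 (hcov (hmem m))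
    exact ⟨c, hc, hmc⟩
  choose f hf hfd using hex
  have hcard : (Finset.univ : Finset (Fin n → Fin (2 ^ tri J))).card ≤ F.card := by
    refine Finset.card_le_card_of_injOn f (fun m _ => hf m) fun m _ m' _ hmm => ?_
    by_contra hne
    obtain ⟨i, hi⟩ := Function.ne_iff.1 hne
    have h1 := hfd m
    have h2 := hfd m'
    rw [← hmm] at h2
    have h3 := dist_triangle_right (P m) (P m') (f m)
    have h4 := EuclideanSpace.dist_coord_le (P m) (P m') i
    have h5 : dist (P m i) (P m' i) =
        pieceScale τ J / 2 ^ tri J * |((m i : ℕ) : ℝ) - ((m' i : ℕ) : ℝ)| := by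
      simp only [hP, PiLp.smul_apply, smul_eq_mul, Real.dist_eq]
      rw [← mul_sub, ← sub_div, abs_mul, abs_div, abs_of_pos (pieceScale_pos τ J),
        abs_of_pos (by positivity : (0 : ℝ) < 2 ^ tri J)]
      ring
    have h6 : (1 : ℝ) ≤ |((m i : ℕ) : ℝ) - ((m' i : ℕ) : ℝ)| := by
      have : (1 : ℤ) ≤ |((m i : ℕ) : ℤ) - ((m' i : ℕ) : ℤ)| :=
        Int.one_le_abs (sub_ne_zero.2 fun h => hi (Fin.ext (by exact_mod_cast h)))
      exact_mod_cast this
    rw [pieceScale_div_eq h0] at h5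
    have h7 : (0 : ℝ) < 2 ^ (-((tri J : ℝ) / τ)) := Real.rpow_pos_of_pos two_pos _
    nlinarith
  rw [Finset.card_univ, Fintype.card_fun, Fintype.card_fin, Fintype.card_fin] at hcard
  calc (2 : ℝ) ^ ((n : ℝ) * tri J) = (((2 ^ tri J) ^ n : ℕ) : ℝ) := by
        rw [mul_comm, Real.rpow_mul two_pos.le, Real.rpow_natCast, Real.rpow_natCast]
        push_cast
        rfl
    _ ≤ F.card := by exact_mod_cast hcard
    _ ≤ N := hF

/-- For each `ε` the finest grid whose mesh exceeds `2 * ε` is counted. Passing to the next mesh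
costs a term linear in the index, covered by the gap between `t` and `n * τ`. -/
lemma coverLowerBound_multiscale_stdProd (h0 : 0 < τ) (hn : 0 < n) :
    CoverLowerBound (multiscale (n := n) τ fun J => stdProd n (1 / 2) (Iio J)) (n * τ) := by
  intro t' ht'
  have hnτ : 0 < n * τ := mul_pos (by exact_mod_cast hn) h0
  set t := max t' 0 with ht
  have ht0 : 0 ≤ t := le_max_right _ _
  have htn : t < n * τ := max_lt ht' hnτ
  obtain ⟨C, -, hC⟩ := exists_le_mul_tri_add
    (show 0 < (n * τ - t) / (t + 1) from div_pos (by linarith) (by linarith))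
  refine ⟨2 ^ (-t) * 2 ^ (-(t * C / τ)), by positivity, 1 / 2, by norm_num,
    fun ε hε hε2 N hN => ?_⟩
  have hlim : Tendsto (fun J => (2 : ℝ) ^ (-(tri J / τ))) atTop (𝓝 0) := by
    have h1 : Tendsto (fun J => (tri J : ℝ) / τ) atTop atTop :=
      (tendsto_natCast_atTop_atTop.comp tendsto_tri).atTop_div_const h0
    have h2 := (tendsto_rpow_atBot_of_base_gt_one 2 one_lt_two).comp
      (tendsto_neg_atTop_atBot.comp h1)
    exact h2
  have hex : ∃ J, (2 : ℝ) ^ (-(tri J / τ)) ≤ 2 * ε := by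
    obtain ⟨J, hJ⟩ := (hlim.eventually_lt_const (by positivity : 0 < 2 * ε)).exists
    exact ⟨J, hJ.le⟩
  classical
  -- The mesh at index `0` is `1`, larger than `2 * ε` because `ε < 1 / 2`.
  obtain ⟨m, hm⟩ : ∃ m, Nat.find hex = m + 1 := by
    refine Nat.exists_eq_succ_of_ne_zero fun h => ?_
    have := Nat.find_spec hex
    rw [h] at this
    simp at this
    linarith
  have hle : (2 : ℝ) ^ (-(tri (m + 1) / τ)) ≤ 2 * ε := hm ▸ Nat.find_spec hex
  have hgt : 2 * ε < 2 ^ (-((tri m : ℝ) / τ)) := not_le.1 (Nat.find_min hex (by omega))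
  have hNm := two_pow_mul_tri_le_of_covers h0 hgt hN
  have hexp : t * (tri (m + 1) / τ) ≤ n * tri m + t * C / τ := by
    have h5 := hC m
    have h6 : t * ((n * τ - t) / (t + 1)) ≤ n * τ - t := by
      rw [mul_div_assoc', div_le_iff₀ (by linarith)]
      nlinarith
    have h7 : (0 : ℝ) ≤ tri m := Nat.cast_nonneg _
    rw [tri_succ, mul_div_assoc', div_le_iff₀ h0, add_mul, div_mul_cancel₀ _ h0.ne']
    push_cast
    nlinarith
  have h8 : (2 * ε) ^ (-t) ≤ 2 ^ (n * tri m + t * C / τ) := by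
    calc (2 * ε) ^ (-t) ≤ ((2 : ℝ) ^ (-(tri (m + 1) / τ))) ^ (-t) :=
          Real.rpow_le_rpow_of_nonpos (by positivity) hle (by linarith)
      _ = 2 ^ (t * (tri (m + 1) / τ)) := by
          rw [← Real.rpow_mul two_pos.le]
          congr 1
          ring
      _ ≤ _ := Real.rpow_le_rpow_of_exponent_le one_le_two hexp
  calc 2 ^ (-t) * 2 ^ (-(t * C / τ)) * ε ^ (-t')
      ≤ 2 ^ (-t) * 2 ^ (-(t * C / τ)) * ε ^ (-t) := by
        refine mul_le_mul_of_nonneg_left ?_ (by positivity)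
        exact Real.rpow_le_rpow_of_exponent_ge hε (by linarith)
          (neg_le_neg (le_max_left _ _))
    _ = (2 * ε) ^ (-t) * 2 ^ (-(t * C / τ)) := by
        rw [Real.mul_rpow two_pos.le hε.le]; ring
    _ ≤ 2 ^ (n * tri m + t * C / τ) * 2 ^ (-(t * C / τ)) :=
        mul_le_mul_of_nonneg_right h8 (by positivity)
    _ = 2 ^ ((n : ℝ) * tri m) := by
        rw [← Real.rpow_add two_pos]
        congr 1
        ring
    _ ≤ N := hNm

lemma packingDim_eq {X : Type*} [MetricSpace X] [SecondCountableTopology X] {A : Set X} {t : ℝ}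
    (ht : 0 ≤ t) (h1 : CoverBound A t) (h2 : ENNReal.ofReal t ≤ dimH A) :
    packingDim A = ENNReal.ofReal t := by
  borelize X
  exact le_antisymm (packingDim_le_of_coverBound ht h1) (h2.trans (dimH_le_packingDim A))

lemma hasBoxDim_of_le_dimH {X : Type*} [MetricSpace X] {A : Set X} {t : ℝ} (hne : A.Nonempty)
    (h1 : CoverBound A t) (h2 : ENNReal.ofReal t ≤ dimH A) : HasBoxDim A t := by
  borelize X
  exact hasBoxDim_of_coverBound h1 (coverLowerBound_of_le_dimH hne h2)

lemma box_exponent_eq (hk : k < n) (s : ℝ) :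
    (1 - ((n : ℝ) - k) / (2 * (n : ℝ) ^ 2)) * s =
      (k + (n - k) * (1 - 1 / (2 * n : ℝ))) * (s / n) := by
  have hn : (n : ℝ) ≠ 0 := by exact_mod_cast (by omega : n ≠ 0)
  field_simp
  ring

lemma box_exponent_le (hk : k < n) {s : ℝ} (hs : s ∈ Icc (0 : ℝ) n) :
    (1 - ((n : ℝ) - k) / (2 * (n : ℝ) ^ 2)) * s ≤ n := by
  have hnk : (0 : ℝ) ≤ n - k := sub_nonneg.2 (by exact_mod_cast hk.le)
  have : 0 ≤ ((n : ℝ) - k) / (2 * (n : ℝ) ^ 2) := by positivity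
  nlinarith [hs.1, hs.2]

lemma exists_box_construction (hk : k < n) {s : ℝ} (hs0 : 0 < s) (hsn : s < n) :
    ∃ S B : Set (EuclideanSpace ℝ (Fin n)), IsCompact S ∧ IsCompact B ∧ S.Nonempty ∧
      ContainsSkeletonAroundEach k B S ∧ HasBoxDim S s ∧
      HasBoxDim B (max (k : ℝ) ((1 - ((n : ℝ) - k) / (2 * (n : ℝ) ^ 2)) * s)) := by
  have hn : 0 < n := by omega
  have hn' : (0 : ℝ) < n := by exact_mod_cast hn
  have h0 : 0 < s / n := by positivity
  have h1 : s / n < 1 := (div_lt_one hn').2 hsn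
  have hb0 : (0 : ℝ) < 1 / 2 := by norm_num
  have hns : n * (s / n) = s := mul_div_cancel₀ _ hn'.ne'
  obtain ⟨D, hDc, hDne, hDub, hDlb⟩ := exists_isCompact_dim_eq hn
    (t := max (k : ℝ) ((1 - ((n : ℝ) - k) / (2 * (n : ℝ) ^ 2)) * s))
    ⟨le_max_of_le_left (Nat.cast_nonneg _),
      max_le (by exact_mod_cast hk.le) (box_exponent_le hk ⟨hs0.le, hsn.le⟩)⟩
  refine ⟨multiscale (s / n) fun J => stdProd n (1 / 2) (Iio J),
    (multiscale (s / n) fun J => skelSet n k (1 / 2) (Iio J)) ∪ D,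
    isCompact_multiscale h0 h1 (fun J => isCompact_stdProd n hb0 le_rfl _)
      (fun J => stdProd_subset_closedBall hb0 le_rfl _),
    (isCompact_multiscale h0 h1 (fun J => isCompact_skelSet n k hb0 le_rfl _)
      (fun J => skelSet_subset_closedBall hb0 le_rfl _)).union hDc,
    insert_nonempty _ _,
    (containsSkeletonAroundEach_multiscale hb0 le_rfl).mono subset_union_left, ?_, ?_⟩
  · have h2 := coverBound_multiscale_stdProd hn h0 h1
    have h3 := coverLowerBound_multiscale_stdProd h0 hn
    rw [hns] at h2 h3
    exact hasBoxDim_of_coverBound h2 h3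
  · have h2 := coverBound_multiscale_skelSet hk h0 h1
    rw [← box_exponent_eq hk] at h2
    exact hasBoxDim_of_le_dimH hDne.inr (h2.union hDub) (hDlb.trans (dimH_mono subset_union_right))

end Constructions

end

theorem mainTheorem2 (n k : ℕ) (hk : k < n) (s : ℝ) (hs : s ∈ Set.Icc (0 : ℝ) (n : ℝ)) :
    (∃ S B : Set (EuclideanSpace ℝ (Fin n)),
      IsCompact S ∧ IsCompact B ∧ S.Nonempty ∧
      ContainsSkeletonAroundEach k B S ∧
      packingDim S = ENNReal.ofReal s ∧
      packingDim B = ENNReal.ofReal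
        ((k : ℝ) + ((n : ℝ) - (k : ℝ)) * (2 * (n : ℝ) - 1) / (2 * (n : ℝ) ^ 2) * s)) ∧
    (∃ S' B' : Set (EuclideanSpace ℝ (Fin n)),
      IsCompact S' ∧ IsCompact B' ∧ S'.Nonempty ∧
      ContainsSkeletonAroundEach k B' S' ∧
      HasBoxDim S' s ∧
      HasBoxDim B' (max (k : ℝ) ((1 - ((n : ℝ) - (k : ℝ)) / (2 * (n : ℝ) ^ 2)) * s))) := by
  obtain ⟨S, B, hSc, hBc, hSne, hBne, hSB, hS1, hS2, hB1, hB2⟩ :=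
    exists_homogeneous_construction hk hs
  refine ⟨⟨S, B, hSc, hBc, hSne, hSB, packingDim_eq hs.1 hS1 hS2,
    packingDim_eq (packing_exponent_mem hk hs).1 hB1 hB2⟩, ?_⟩
  -- The multiscale union needs `0 < s / n < 1`. At either end the homogeneous sets work: both
  -- exponents are `k` for `s = 0` and `n - (n - k) / (2 * n)` for `s = n`.
  rcases hs.1.eq_or_lt with h0 | h0
  · refine ⟨S, B, hSc, hBc, hSne, hSB, hasBoxDim_of_le_dimH hSne hS1 hS2, ?_⟩
    have h := hasBoxDim_of_le_dimH hBne hB1 hB2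
    rw [← h0, mul_zero, add_zero] at h
    rwa [← h0, mul_zero, max_eq_left (Nat.cast_nonneg _)]
  rcases hs.2.eq_or_lt with h1 | h1
  · refine ⟨S, B, hSc, hBc, hSne, hSB, hasBoxDim_of_le_dimH hSne hS1 hS2, ?_⟩
    have h := hasBoxDim_of_le_dimH hBne hB1 hB2
    have hn : (1 : ℝ) ≤ n := by exact_mod_cast (by omega : 1 ≤ n)
    have hnk : (0 : ℝ) ≤ n - k := sub_nonneg.2 (by exact_mod_cast hk.le)
    have hle : (k : ℝ) ≤ (1 - ((n : ℝ) - k) / (2 * (n : ℝ) ^ 2)) * s := by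
      rw [h1]
      have : (1 - ((n : ℝ) - k) / (2 * (n : ℝ) ^ 2)) * n = n - (n - k) / (2 * n) := by
        field_simp
      have h3 : ((n : ℝ) - k) / (2 * n) ≤ n - k := div_le_self hnk (by linarith)
      linarith
    rw [max_eq_right hle]
    have heq : (1 - ((n : ℝ) - k) / (2 * (n : ℝ) ^ 2)) * s =
        k + ((n : ℝ) - k) * (2 * n - 1) / (2 * (n : ℝ) ^ 2) * s := by
      rw [h1]
      field_simp
      ring
    rwa [heq]
  · exact exists_box_construction hk h0 h1
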